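/- All locally compact groups are Hausdorff and second countable. Let $G,H,K$ be unimodular locally compact groups with fixed (two-sided invariant) Haar measures $\gamma,\eta,\kappa$. A polyhomomorphism $G\rightsquigarrow H$ is either a pair $(R,\rho)$, where $R\subset G\times H$ is a closed subgroup and $\rho$ is a Haar measure on $R$ whose images under the projections to $G$ and to $H$ are dominated by $\gamma$ and by $\eta$ respectively, or the zero measure on $G\times H$. Let $\mathrm{Polh}(G,H)$ be the set of polyhomomorphisms, with the weak topology: the coarsest topology for which the maps $$(R,\rho)\mapsto\int_R\varphi(g)\,\psi(h)\,d\rho(g,h),\qquad 0\mapsto 0,$$ are continuous for all $\varphi\in C_c(G)$, $\psi\in C_c(H)$. Thus $(R_j,\rho_j)\to(R,\rho)$ if and only if all these integrals converge. For a subgroup $R\subset G\times H$ let $\operatorname{dom}R\subset G$ and $\operatorname{im}R\subset H$ be its projections, and $\ker R=\{g:(g,1)\in R\}$, $\operatorname{indef}R=\{h:(1,h)\in R\}$. For a nonzero polyhomomorphism $(R,\rho)$ let $\alpha(R)$, $\beta(R)$ be the constants for which the images of $\rho$ in $G$ and in $H$ are $\alpha(R)\,\gamma|_{\operatorname{dom}R}$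 and $\beta(R)\,\eta|_{\operatorname{im}R}$. The product of nonzero polyhomomorphisms $R:G\rightsquigarrow H$ and $T:H\rightsquigarrow K$ is the polyhomomorphism $S=TR:G\rightsquigarrow K$ with underlying subgroup $\{(g,k):\exists h\in H,\ (g,h)\in R,\ (h,k)\in T\}$ and $$\alpha(S)=\frac{\alpha(R)\,\alpha(T)}{[\operatorname{indef}R:\operatorname{indef}R\cap\operatorname{dom}T]},\qquad \beta(S)=\frac{\beta(R)\,\beta(T)}{[\ker T:\ker T\cap\operatorname{im}R]}.$$ A product with a zero factor is zero. Then: a) the space $\mathrm{Polh}(G,H)$ is compact and metrizable; b) the product of polyhomomorphisms exists, is unique, and is separately continuous: for fixed $T\in\mathrm{Polh}(H,K)$ the map $\mathrm{Polh}(G,H)\to\mathrm{Polh}(G,K)$, $R\mapsto TR$, is continuous, and for fixed $R\in\mathrm{Polh}(G,H)$ the map $\mathrm{Polh}(H,K)\to\mathrm{Polh}(G,K)$, $T\mapsto TR$, is continuous. -/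

import Mathlib

open MeasureTheory Topology
open scoped NNReal CompactlySupported

section Polyhomomorphisms

variable {G H K : Type*} [Group G] [Group H] [Group K]

namespace MulRel

/-- The domain of a multiplicative relation `R ⊆ G × H`: its projection to `G`. -/
def dom (R : Subgroup (G × H)) : Subgroup G := R.map (MonoidHom.fst G H)

/-- The image of a multiplicative relation `R ⊆ G × H`: its projection to `H`. -/
def im (R : Subgroup (G × H)) : Subgroup H := R.map (MonoidHom.snd G H)

/-- The kernel of a multiplicative relation: the intersection of `R` with `G`. -/
def ker (R : Subgroup (G × H)) : Subgroup G := R.comap (MonoidHom.inl G H)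

/-- The indefinity of a multiplicative relation: the intersection of `R` with `H`. -/
def indef (R : Subgroup (G × H)) : Subgroup H := R.comap (MonoidHom.inr G H)

/-- The product `TR` of multiplicative relations: all `(x, z)` for which there is `y` with
`(x, y) ∈ R` and `(y, z) ∈ T`. -/
def comp (T : Subgroup (H × K)) (R : Subgroup (G × H)) : Subgroup (G × K) where
  carrier := {p | ∃ y : H, (p.1, y) ∈ R ∧ (y, p.2) ∈ T}
  one_mem' := ⟨1, R.one_mem, T.one_mem⟩
  mul_mem' := by
    rintro p q ⟨y, hy, hy'⟩ ⟨z, hz, hz'⟩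
    exact ⟨y * z, R.mul_mem hy hz, T.mul_mem hy' hz'⟩
  inv_mem' := by
    rintro p ⟨y, hy, hy'⟩
    exact ⟨y⁻¹, R.inv_mem hy, T.inv_mem hy'⟩

end MulRel

variable [TopologicalSpace G] [TopologicalSpace H] [TopologicalSpace K]
  [MeasurableSpace G] [MeasurableSpace H] [MeasurableSpace K]

/-- A nonzero polyhomomorphism: a closed subgroup `R` of `G × H` with a fixed Haar measure `ρ` such
that the images of `ρ` in `G` and in `H` are dominated by the given Haar measures `γ` and `η`. -/
structure NonzeroPolh (γ : Measure G) (η : Measure H) where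
  rel : Subgroup (G × H)
  isClosed : IsClosed (rel : Set (G × H))
  haar : Measure rel
  isHaar : haar.IsHaarMeasure
  map_fst_le : haar.map (fun r : rel => (r : G × H).1) ≤ γ
  map_snd_le : haar.map (fun r : rel => (r : G × H).2) ≤ η

/-- The set of all polyhomomorphisms: those carried by a closed subgroup with a Haar measure,
and the zero measure on `G × H`. -/
inductive Polh (γ : Measure G) (η : Measure H)
  | zero : Polh γ η
  | of (R : NonzeroPolh γ η) : Polh γ η

namespace NonzeroPolh

variable {γ : Measure G} {η : Measure H} {κ : Measure K}

/-- `a` is the constant `α(R)`: the image of the Haar measure of `R` in `G` is `a γ` on `dom R`. -/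
def IsAlpha (R : NonzeroPolh γ η) (a : ℝ≥0) : Prop :=
  R.haar.map (fun r : R.rel => (r : G × H).1) = a • γ.restrict (MulRel.dom R.rel : Set G)

/-- `b` is the constant `β(R)`: the image of the Haar measure of `R` in `H` is `b η` on `im R`. -/
def IsBeta (R : NonzeroPolh γ η) (b : ℝ≥0) : Prop :=
  R.haar.map (fun r : R.rel => (r : G × H).2) = b • η.restrict (MulRel.im R.rel : Set H)

/-- `S` is the product `TR` of nonzero polyhomomorphisms: its underlying relation is the product
of the relations, and
`α(S) = α(R) α(T) / [indef R : indef R ∩ dom T]`, `β(S) = β(R) β(T) / [ker T : ker T ∩ im R]`.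
Here `A.relIndex B` is the index of `A ⊓ B` in `B`. -/
def IsProduct (R : NonzeroPolh γ η) (T : NonzeroPolh η κ) (S : NonzeroPolh γ κ) : Prop :=
  S.rel = MulRel.comp T.rel R.rel ∧
    ∃ aR bR aT bT aS bS : ℝ≥0,
      R.IsAlpha aR ∧ R.IsBeta bR ∧ T.IsAlpha aT ∧ T.IsBeta bT ∧ S.IsAlpha aS ∧ S.IsBeta bS ∧
      aS = aR * aT / ((MulRel.dom T.rel).relIndex (MulRel.indef R.rel) : ℝ≥0) ∧
      bS = bR * bT / ((MulRel.im R.rel).relIndex (MulRel.ker T.rel) : ℝ≥0)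

end NonzeroPolh

namespace Polh

variable {γ : Measure G} {η : Measure H} {κ : Measure K}

/-- `S` is the product `TR` of the polyhomomorphisms `R : G ⇝ H` and `T : H ⇝ K`; a product with a
zero factor is zero. -/
def IsProduct : Polh γ η → Polh η κ → Polh γ κ → Prop
  | of R, of T, of S => R.IsProduct T S
  | of _, of _, zero => False
  | zero, _, S => S = zero
  | of _, zero, S => S = zero

open Classical in
/-- The product `TR` of the polyhomomorphisms `R : G ⇝ H` and `T : H ⇝ K`. The value `zero` in the
second branch is a placeholder for the case where no product exists. -/
noncomputable def mul (T : Polh η κ) (R : Polh γ η) : Polh γ κ :=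
  if h : ∃ S, IsProduct R T S then h.choose else zero

/-- The integral of `φ(g) ψ(h)` with respect to a polyhomomorphism. -/
noncomputable def integral (φ : C_c(G, ℝ)) (ψ : C_c(H, ℝ)) : Polh γ η → ℝ
  | zero => 0
  | of R => ∫ r : R.rel, (φ (r : G × H).1 * ψ (r : G × H).2) ∂(R.haar)

/-- The topology of weak convergence: the coarsest one for which all integrals of `φ(g) ψ(h)`,
with `φ`, `ψ` continuous of compact support, depend continuously on the polyhomomorphism. -/
noncomputable instance : TopologicalSpace (Polh γ η) :=
  TopologicalSpace.induced
    (fun (R : Polh γ η) (p : C_c(G, ℝ) × C_c(H, ℝ)) => integral p.1 p.2 R) inferInstance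

theorem tendsto_iff {ι : Type*} {l : Filter ι} {R : ι → Polh γ η} {R₀ : Polh γ η} :
    Filter.Tendsto R l (𝓝 R₀) ↔ ∀ (φ : C_c(G, ℝ)) (ψ : C_c(H, ℝ)),
      Filter.Tendsto (fun j => integral φ ψ (R j)) l (𝓝 (integral φ ψ R₀)) := by
  rw [nhds_induced, Filter.tendsto_comap_iff, tendsto_pi_nhds, Prod.forall]
  rfl

end Polh

end Polyhomomorphisms

/-!
A nonzero polyhomomorphism `(R, ρ)` has projections `R → G` and `R → H` whose image measures are
locally finite. A packing argument makes such homomorphisms proper (`isProperMap_of_map_le`), and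
Steinhaus' theorem makes their ranges open (`isOpen_range_of_map_le`); hence their kernels are
compact and uniqueness of Haar measure provides the constants `α(R)` and `β(R)`
(`exists_map_eq_smul_restrict`).

*Products.* Let `P = {(r, t) | r_H = t_H}` be the fibre product of `R` and `T` over `H`. Its Haar
measure `π` maps to multiples of the restrictions of `ρ` and `τ` to open subgroups. If the multiple
of `ρ` is normalised to `α(T)`, comparing the further images in `H` shows that the multiple of `τ`
is `β(R)` (`fiberProduct.exists_haar_map_eq`). The image of `π` in `G × K` is a Haar measure on
`TR`, and since restricting a Haar measure to an open subgroup divides the constant by an index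
(`map_restrict_eq_smul_restrict`), it has both constants required of the product. A
polyhomomorphism is determined by its relation and `α`, so the product is unique.

*Continuity.* The compact kernel of `T → H` acts on `P` by translations preserving `π`, so in
`∫ φ(g) χ(k) dπ` the function `χ` may be averaged over this kernel. The average descends to a
function `χ'` in `C_c(H)` (`exists_average`), which gives `∫ φ χ d(TR) = ∫ φ χ' dR` with `χ'`
depending on `T` and `χ` only (`NonzeroPolh.exists_integral_eq_left`), and symmetrically on the
other side. Separate continuity is then the definition of the topology.

*Compactness.* Viewed as measures on `G × H`, polyhomomorphisms are the measures with dominated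
images that are invariant under translation by each point of their support
(`Polh.exists_toMeasure_eq`). They are uniformly bounded on compact sets, so along an ultrafilter
they converge vaguely to a measure given by the Riesz–Markov–Kakutani theorem, and both properties
survive in the limit. Countably many of the integrals `∫ φ ψ dρ` determine `ρ`, which embeds the
compact space in a countable product of lines and makes it metrizable.
-/

/-! ### Proper homomorphisms of locally compact groups -/

section ProperHom

theorem isCompact_ker_of_isProperMap {L X : Type*} [Group L] [TopologicalSpace L] [Group X]
    [TopologicalSpace X] (p : L →* X) (hp : IsProperMap p) : IsCompact (p.ker : Set L) := by
  convert hp.isCompact_preimage (isCompact_singleton (x := (1 : X))) using 1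
  ext
  simp [MonoidHom.mem_ker]

variable {L X : Type*} [Group L] [TopologicalSpace L] [IsTopologicalGroup L]
  [MeasurableSpace L] [BorelSpace L] [Group X] [TopologicalSpace X]

open Pointwise in
/-- A continuous homomorphism whose image measure is locally finite is proper: a closed set of
finite measure contains only finitely many disjoint translates of a given neighbourhood. -/
theorem isProperMap_of_map_le [T2Space L] [LocallyCompactSpace L]
    [IsTopologicalGroup X] [T2Space X] [LocallyCompactSpace X]
    [MeasurableSpace X] [BorelSpace X]
    (l : Measure L) [l.IsHaarMeasure] (ξ : Measure X)
    [IsFiniteMeasureOnCompacts ξ] (p : L →* X) (hp : Continuous p) (h : l.map p ≤ ξ) :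
    IsProperMap p := by
  refine isProperMap_iff_isCompact_preimage.2 ⟨hp, fun C hC => ?_⟩
  obtain ⟨V, hV, hV1⟩ := exists_compact_mem_nhds (1 : X)
  have hV' : p ⁻¹' V ∈ 𝓝 (1 : L) := hp.continuousAt (by simpa using hV1)
  obtain ⟨W, hW1, hWV, hW⟩ := local_compact_nhds hV'
  have hfin : l (p ⁻¹' (C * V)) ≠ ⊤ := by
    have hCV := hC.mul hV
    rw [← Measure.map_apply hp.measurable hCV.measurableSet]
    exact ((h _).trans_lt hCV.measure_lt_top).ne
  -- Otherwise infinitely many disjoint translates of `W` fit into the preimage of `C * V`.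
  by_contra hcon
  have key : ∀ s : Finset L, (∀ x ∈ s, x ∈ p ⁻¹' C) →
      ∃ y, y ∈ p ⁻¹' C ∧ ∀ x ∈ s, Disjoint (x • W) (y • W) := by
    intro s _
    by_contra! hs
    refine hcon (IsCompact.of_isClosed_subset
      (s.isCompact_biUnion fun x _ => (hW.mul hW.inv).smul x)
      (hC.isClosed.preimage hp) fun y hy => ?_)
    obtain ⟨x, hx, hxy⟩ := hs y hy
    obtain ⟨z, ⟨a, ha, rfl⟩, ⟨b, hb, hab⟩⟩ := Set.not_disjoint_iff.1 hxy
    refine Set.mem_biUnion hx ⟨a * b⁻¹, Set.mul_mem_mul ha (Set.inv_mem_inv.2 hb), ?_⟩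
    simp only [smul_eq_mul] at hab ⊢
    rw [← mul_assoc, ← hab, mul_inv_cancel_right]
  obtain ⟨f, hf, hdisj⟩ := exists_seq_of_forall_finset_exists _ _ key
  have hpair : Pairwise (Function.onFun Disjoint fun n => f n • W) := by
    intro m n hmn
    rcases lt_or_gt_of_ne hmn with h' | h'
    · exact hdisj _ _ h'
    · exact (hdisj _ _ h').symm
  have hpos : 0 < l W := Measure.measure_pos_of_mem_nhds l hW1
  have hsub : (⋃ n, f n • W) ⊆ p ⁻¹' (C * V) := by
    refine Set.iUnion_subset fun n => ?_
    rintro _ ⟨w, hw, rfl⟩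
    simp only [Set.mem_preimage, smul_eq_mul, map_mul]
    exact Set.mul_mem_mul (hf n) (hWV hw)
  have := Measure.finite_const_le_meas_of_disjoint_iUnion l hpos
    (fun n => (hW.smul (f n)).measurableSet) hpair
    (ne_top_of_le_ne_top hfin (measure_mono hsub))
  simp only [measure_smul, le_refl, Set.ofPred_true] at this
  exact Set.infinite_univ this

/-- The range is closed since `p` is proper, and has positive measure, so Steinhaus' theorem
applies. -/
theorem isOpen_range_of_map_le [T2Space L] [LocallyCompactSpace L]
    [IsTopologicalGroup X] [T2Space X] [LocallyCompactSpace X]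
    [MeasurableSpace X] [BorelSpace X]
    [SecondCountableTopology X] (l : Measure L)
    [l.IsHaarMeasure] (ξ : Measure X)
    [ξ.IsHaarMeasure] (p : L →* X) (hp : Continuous p) (h : l.map p ≤ ξ) :
    IsOpen (p.range : Set X) := by
  have hcl : IsClosed (p.range : Set X) := by
    simpa using (isProperMap_of_map_le l ξ p hp h).isClosedMap.isClosed_range
  have hpos : 0 < ξ (p.range : Set X) := by
    refine lt_of_lt_of_le ?_ (h _)
    rw [Measure.map_apply hp.measurable hcl.measurableSet]
    have : p ⁻¹' (p.range : Set X) = Set.univ := by ext; simp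
    rw [this]
    exact Measure.measure_univ_pos.2 (NeZero.ne l)
  refine Subgroup.isOpen_of_mem_nhds p.range (g := 1) ?_
  refine Filter.mem_of_superset
    (Measure.div_mem_nhds_one_of_haar_pos ξ _ hcl.measurableSet hpos) ?_
  rintro _ ⟨a, ha, b, hb, rfl⟩
  exact p.range.div_mem ha hb

/-- Uniqueness of Haar measure on the open subgroup `p.range`. -/
theorem exists_map_eq_smul_restrict [IsTopologicalGroup X] [T2Space X] [LocallyCompactSpace X]
    [MeasurableSpace X] [BorelSpace X]
    [SecondCountableTopology X] (l : Measure L)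
    [l.IsHaarMeasure] (ξ : Measure X) [ξ.IsHaarMeasure] (p : L →* X) (hp : IsProperMap p)
    (ho : IsOpen (p.range : Set X)) :
    ∃ a : ℝ≥0, a ≠ 0 ∧ l.map p = a • ξ.restrict (p.range : Set X) := by
  have hr : Continuous p.rangeRestrict := hp.continuous.subtype_mk _
  have hrp : IsProperMap p.rangeRestrict :=
    isProperMap_of_comp_of_inj hr continuous_subtype_val
      (by exact hp) Subtype.val_injective
  have : LocallyCompactSpace p.range := ho.isOpenEmbedding_subtypeVal.locallyCompactSpace
  have hm : (l.map p.rangeRestrict).IsHaarMeasure :=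
    Measure.isHaarMeasure_map l _ hr p.rangeRestrict_surjective
      (isProperMap_iff_tendsto_cocompact.1 hrp).2
  have hx : (ξ.comap (p.range.subtype)).IsHaarMeasure :=
    Measure.IsHaarMeasure.comap (mH := inferInstance) ξ (f := p.range.subtype)
      ho.isOpenEmbedding_subtypeVal
  have : SecondCountableTopology p.range :=
    TopologicalSpace.Subtype.secondCountableTopology (p.range : Set X)
  have := Measure.isMulLeftInvariant_eq_smul (l.map p.rangeRestrict) (ξ.comap (p.range.subtype))
  refine ⟨_, (Measure.haarScalarFactor_pos_of_isHaarMeasure (l.map p.rangeRestrict)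
    (ξ.comap (p.range.subtype))).ne', ?_⟩
  have h2 := congrArg (Measure.map (Subtype.val : p.range → X)) this
  rw [Measure.map_map measurable_subtype_coe hr.measurable, Measure.map_smul] at h2
  exact h2.trans (by rw [← map_comap_subtype_coe ho.measurableSet]; rfl)

/-- If the image of `l` is `a ξ` on the range of `p`, then restricting `l` to an open subgroup `M`
divides the constant by the index `[ker p : ker p ∩ M]`, because `p⁻¹(p(M))` is a disjoint union
of that many translates of `M`. -/
theorem map_restrict_eq_smul_restrict [MeasurableSpace X] [BorelSpace X]
    (l : Measure L)
    [l.IsHaarMeasure] (ξ : Measure X) (p : L →* X) (hp : IsProperMap p) (a : ℝ≥0)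
    (ha : l.map p = a • ξ.restrict (p.range : Set X))
    (M : Subgroup L) (hM : IsOpen (M : Set L)) (hpM : IsOpen (M.map p : Set X)) :
    M.relIndex p.ker ≠ 0 ∧
    (l.restrict (M : Set L)).map p =
      (a / (M.relIndex p.ker : ℝ≥0)) • ξ.restrict (M.map p : Set X) := by
  have : CompactSpace p.ker := isCompact_iff_compactSpace.1 (isCompact_ker_of_isProperMap p hp)
  have hMo : IsOpen ((M.subgroupOf p.ker : Subgroup p.ker) : Set p.ker) :=
    hM.preimage continuous_subtype_val
  have : Finite (p.ker ⧸ M.subgroupOf p.ker) := Subgroup.quotient_finite_of_isOpen _ hMo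
  have hidx : M.relIndex p.ker ≠ 0 := by
    rw [Subgroup.relIndex, Subgroup.index]
    exact Nat.card_pos.ne'
  refine ⟨hidx, ?_⟩
  have hmp := hp.continuous.measurable
  ext A hA
  have hA' : MeasurableSet (A ∩ (M.map p : Set X)) := hA.inter hpM.measurableSet
  have h1 : l (p ⁻¹' (A ∩ (M.map p : Set X))) = a * ξ (A ∩ (M.map p : Set X)) := by
    rw [← Measure.map_apply hmp hA', ha, Measure.smul_apply, Measure.restrict_apply hA']
    have : A ∩ (M.map p : Set X) ∩ (p.range : Set X) = A ∩ (M.map p : Set X) := by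
      refine Set.inter_eq_left.2 ?_
      rintro _ ⟨_, x, -, rfl⟩
      exact ⟨x, rfl⟩
    rw [this]; rfl
  let B : Set L := p ⁻¹' A ∩ M
  have hB : MeasurableSet B := (hmp hA).inter hM.measurableSet
  -- The representatives `c x` of `ker p / (ker p ∩ M)` move `M` onto the pieces of `p⁻¹(p(M))`.
  let c : p.ker ⧸ M.subgroupOf p.ker → L := fun x => (x.out : p.ker)
  have hc : ∀ x, p (c x) = 1 := fun x => (x.out : p.ker).2
  have h2 : p ⁻¹' (A ∩ (M.map p : Set X)) = ⋃ x, (fun y => (c x)⁻¹ * y) ⁻¹' B := by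
    ext y
    simp only [Set.mem_preimage, Set.mem_inter_iff, Set.mem_iUnion, B, map_mul, map_inv, hc,
      inv_one, one_mul, SetLike.mem_coe, Subgroup.mem_map]
    constructor
    · rintro ⟨hyA, m, hm, hmy⟩
      have hk : y * m⁻¹ ∈ p.ker := by simp [MonoidHom.mem_ker, hmy]
      refine ⟨QuotientGroup.mk (s := M.subgroupOf p.ker) ⟨y * m⁻¹, hk⟩, hyA, ?_⟩
      have := QuotientGroup.mk_out_eq_mul (M.subgroupOf p.ker) ⟨y * m⁻¹, hk⟩
      obtain ⟨⟨h, hh⟩, hE⟩ := this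
      have hE' : c (QuotientGroup.mk (s := M.subgroupOf p.ker) ⟨y * m⁻¹, hk⟩) = y * m⁻¹ * h :=
        congrArg Subtype.val hE
      rw [hE']
      have hh' : (h : L) ∈ M := hh
      have : (y * m⁻¹ * (h : L))⁻¹ * y = (h : L)⁻¹ * m := by group
      rw [this]
      exact M.mul_mem (M.inv_mem hh') hm
    · rintro ⟨x, hyA, hx⟩
      exact ⟨hyA, _, hx, by simp [hc]⟩
  have hdis : Pairwise (Function.onFun Disjoint fun x => (fun y => (c x)⁻¹ * y) ⁻¹' B) := by
    intro x x' hxx'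
    refine Set.disjoint_left.2 fun y hy hy' => hxx' ?_
    have : (c x)⁻¹ * c x' ∈ M := by
      have := M.mul_mem hy.2 (M.inv_mem hy'.2)
      simpa using this
    rw [← x.out_eq', ← x'.out_eq']
    exact QuotientGroup.eq.2 this
  have h3 : l (p ⁻¹' (A ∩ (M.map p : Set X))) = M.relIndex p.ker * l B := by
    rw [h2, measure_iUnion hdis fun x => (measurable_const_mul _) hB]
    simp_rw [measure_preimage_mul]
    have := Fintype.ofFinite (p.ker ⧸ M.subgroupOf p.ker)
    rw [tsum_fintype, Finset.sum_const, nsmul_eq_mul, Finset.card_univ, ← Nat.card_eq_fintype_card]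
    rfl
  rw [Measure.map_apply hmp hA, Measure.restrict_apply (hmp hA), Measure.smul_apply,
    Measure.restrict_apply hA]
  have h4 := h3.symm.trans h1
  change l B = ((a / (M.relIndex p.ker : ℝ≥0) : ℝ≥0) : ENNReal) * _
  rw [ENNReal.coe_div (by exact_mod_cast hidx), ENNReal.coe_natCast, div_eq_mul_inv,
    mul_comm (a : ENNReal), mul_assoc, ← h4, ← mul_assoc,
    ENNReal.inv_mul_cancel (by exact_mod_cast hidx) (by simp), one_mul]

/-- Averaging a compactly supported function over the compact kernel of a proper homomorphism
`p` with open range makes it a compactly supported continuous function on the target. The function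
`n ↦ f (n t)` is integrated over left translates, so right invariance of `ν` makes the average
constant on the fibres of `p`. -/
theorem exists_average [T2Space L] [LocallyCompactSpace L] [IsTopologicalGroup X]
    [SecondCountableTopology L] (p : L →* X) (hp : IsProperMap p)
    (ho : IsOpen (p.range : Set X)) (ν : Measure p.ker) [IsFiniteMeasure ν]
    [ν.IsMulRightInvariant] (f : C_c(L, ℝ)) :
    ∃ f' : C_c(X, ℝ), (∀ t, f' (p t) = ∫ n : p.ker, f (n * t) ∂ν) ∧
      ∀ x ∉ p.range, f' x = 0 := by
  classical
  have : CompactSpace p.ker := isCompact_iff_compactSpace.1 (isCompact_ker_of_isProperMap p hp)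
  let F : L → ℝ := fun t => ∫ n : p.ker, f (n * t) ∂ν
  have hF : Continuous F := by
    have := continuous_parametric_integral_of_continuous (μ := ν)
      (f := fun (t : L) (n : p.ker) => f (n * t)) (by
        have := f.continuous
        fun_prop) isCompact_univ
    simpa using this
  have hF' : ∀ t t', p t = p t' → F t = F t' := by
    intro t t' h
    have hm : t * t'⁻¹ ∈ p.ker := by simp [MonoidHom.mem_ker, h]
    have := integral_mul_right_eq_self (μ := ν) (fun n : p.ker => f (n * t')) ⟨_, hm⟩
    simp only [F]
    rw [← this]
    simp [mul_assoc]
  let g : X → ℝ := fun x => if h : x ∈ p.range then F h.choose else 0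
  have hg : ∀ t, g (p t) = F t := by
    intro t
    have h : p t ∈ p.range := ⟨t, rfl⟩
    simp only [g, dif_pos h]
    exact hF' _ _ h.choose_spec
  have hg0 : ∀ x ∉ p.range, g x = 0 := fun x hx => dif_neg hx
  have hcl : IsClosed (p.range : Set X) := by simpa using hp.isClosedMap.isClosed_range
  have hr : Continuous p.rangeRestrict := hp.continuous.subtype_mk _
  have hrp : IsProperMap p.rangeRestrict :=
    isProperMap_of_comp_of_inj hr continuous_subtype_val
      (by exact hp) Subtype.val_injective
  have hq := hrp.isClosedMap.isQuotientMap hr p.rangeRestrict_surjective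
  have hgr : ContinuousOn g (p.range : Set X) := by
    rw [continuousOn_iff_continuous_domRestrict]
    refine hq.continuous_iff.2 ?_
    convert hF using 1
    ext t
    exact hg t
  have hgc : Continuous g := by
    refine continuous_iff_continuousAt.2 fun x => ?_
    by_cases hx : x ∈ p.range
    · exact hgr.continuousAt (ho.mem_nhds hx)
    · refine ContinuousAt.congr (continuousAt_const (y := (0 : ℝ))) ?_
      filter_upwards [hcl.isOpen_compl.mem_nhds hx] with y hy
      exact (hg0 y hy).symm
  refine ⟨⟨⟨g, hgc⟩, HasCompactSupport.intro (f.hasCompactSupport.image hp.continuous)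
    fun x hx => ?_⟩, hg, hg0⟩
  by_contra hne
  have hxr : x ∈ p.range := by
    by_contra h
    exact hne (hg0 x h)
  obtain ⟨t, rfl⟩ := hxr
  refine hne ((hg t).trans ?_)
  refine integral_eq_zero_of_ae (ae_of_all _ fun n => ?_)
  by_contra hn
  refine hx ⟨n * t, subset_tsupport f hn, ?_⟩
  rw [map_mul, MonoidHom.mem_ker.1 n.2, one_mul]

open Pointwise in
/-- In an integral over a fibre product `P` of `R` and `T` over `H`, a function on `T` may be
replaced by its average over the kernel of `b : T → H`, since this kernel acts on `P` by measure
preserving translations. -/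
theorem integral_mul_eq_integral_mul_average
    {P R T : Type*} [Group P] [TopologicalSpace P] [IsTopologicalGroup P]
    [SecondCountableTopology P] [MeasurableSpace P] [BorelSpace P]
    [Group R] [TopologicalSpace R]
    [Group T] [TopologicalSpace T] [IsTopologicalGroup T] [SecondCountableTopology T]
    [MeasurableSpace T] [BorelSpace T]
    (π : Measure P) [π.IsHaarMeasure] [SFinite π] (u : P →* R) (v : P →* T)
    (huv : IsProperMap fun x => (u x, v x))
    (a : R →* X) (b : T →* X) (hb : IsProperMap b) (hab : ∀ x, b (v x) = a (u x))
    (hker : ∀ n ∈ b.ker, ∃ x, u x = 1 ∧ v x = n)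
    (ν : Measure b.ker) [IsProbabilityMeasure ν]
    (f : C_c(R, ℝ)) (f₂ : C_c(T, ℝ)) (f' : X → ℝ)
    (hf' : ∀ t, f' (b t) = ∫ n : b.ker, f₂ (n * t) ∂ν) :
    ∫ x, f (u x) * f₂ (v x) ∂π = ∫ x, f (u x) * f' (a (u x)) ∂π := by
  have hcker := isCompact_ker_of_isProperMap b hb
  have : CompactSpace b.ker := isCompact_iff_compactSpace.1 hcker
  have hu : Continuous u := huv.continuous.fst
  have hv : Continuous v := huv.continuous.snd
  -- Each `n` in the kernel acts on `P` through a lift with trivial component in `R`.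
  have h1 : ∀ n : b.ker,
      ∫ x, f (u x) * f₂ (n * v x) ∂π = ∫ x, f (u x) * f₂ (v x) ∂π := by
    intro n
    obtain ⟨y, hy, hy'⟩ := hker n n.2
    have := integral_mul_left_eq_self (μ := π) (fun x => f (u x) * f₂ (v x)) y
    simpa [hy, hy'] using this
  have hint : Integrable (Function.uncurry fun (n : b.ker) (x : P) => f (u x) * f₂ (n * v x))
      (ν.prod π) := by
    refine Continuous.integrable_of_hasCompactSupport ?_ ?_
    · have := f.continuous
      have := f₂.continuous
      unfold Function.uncurry
      fun_prop
    · refine HasCompactSupport.intro (isCompact_univ.prod (huv.isCompact_preimage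
        (f.hasCompactSupport.prod (hcker.mul f₂.hasCompactSupport)))) ?_
      rintro ⟨n, x⟩ hx
      by_contra hne
      refine hx ⟨trivial, ?_, (n : T)⁻¹, b.ker.inv_mem n.2, n * v x, ?_, ?_⟩
      · exact subset_tsupport f (left_ne_zero_of_mul hne)
      · exact subset_tsupport f₂ (right_ne_zero_of_mul hne)
      · simp
  calc ∫ x, f (u x) * f₂ (v x) ∂π
      = ∫ n : b.ker, ∫ x, f (u x) * f₂ (n * v x) ∂π ∂ν := by simp [h1]
    _ = ∫ x, ∫ n : b.ker, f (u x) * f₂ (n * v x) ∂ν ∂π := integral_integral_swap hint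
    _ = ∫ x, f (u x) * f' (a (u x)) ∂π := by
      simp_rw [integral_const_mul, ← hf', hab]

end ProperHom

/-! ### Fibre products -/

section FiberProduct

/-- Constants are compared on a compact neighbourhood of `1` inside `D`, where `ξ` is positive and
finite. -/
theorem le_of_smul_restrict_le {X : Type*} [Group X] [TopologicalSpace X] [LocallyCompactSpace X]
    [MeasurableSpace X] [BorelSpace X] (ξ : Measure X) [ξ.IsHaarMeasure] (D : Subgroup X)
    (hD : IsOpen (D : Set X)) {a b : ℝ≥0} (h : a • ξ.restrict (D : Set X) ≤ b • ξ) : a ≤ b := by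
  obtain ⟨C, hC1, hCD, hC⟩ := local_compact_nhds (hD.mem_nhds D.one_mem)
  have h1 : (a : ENNReal) * ξ C ≤ b * ξ C := by
    have := h C
    rwa [Measure.smul_apply, Measure.restrict_eq_self _ hCD, Measure.smul_apply] at this
  rw [ENNReal.mul_le_mul_iff_left (Measure.measure_pos_of_mem_nhds ξ hC1).ne'
    hC.measure_lt_top.ne] at h1
  exact_mod_cast h1

theorem eq_of_smul_restrict_eq {X : Type*} [Group X] [TopologicalSpace X] [LocallyCompactSpace X]
    [MeasurableSpace X] [BorelSpace X] (ξ : Measure X) [ξ.IsHaarMeasure] (D : Subgroup X)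
    (hD : IsOpen (D : Set X)) {a b : ℝ≥0}
    (h : a • ξ.restrict (D : Set X) = b • ξ.restrict (D : Set X)) : a = b := by
  have hle : ∀ c : ℝ≥0, c • ξ.restrict (D : Set X) ≤ c • ξ := fun c s =>
    mul_le_mul_right (Measure.restrict_apply_le _ _) _
  exact le_antisymm (le_of_smul_restrict_le ξ D hD (h.le.trans (hle b)))
    (le_of_smul_restrict_le ξ D hD (h.ge.trans (hle a)))

variable {A B X : Type*} [Group A] [Group B] [Group X]

/-- The fibre product `{(x, y) | q x = b y}` of two group homomorphisms. -/
def fiberProduct (q : A →* X) (b : B →* X) : Subgroup (A × B) :=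
  MonoidHom.eqLocus (q.comp (MonoidHom.fst A B)) (b.comp (MonoidHom.snd A B))

namespace fiberProduct

variable (q : A →* X) (b : B →* X)

/-- The projection of the fibre product to the first factor. -/
def fst : fiberProduct q b →* A := (MonoidHom.fst A B).comp (fiberProduct q b).subtype

/-- The projection of the fibre product to the second factor. -/
def snd : fiberProduct q b →* B := (MonoidHom.snd A B).comp (fiberProduct q b).subtype

theorem condition (x : fiberProduct q b) : q (fst q b x) = b (snd q b x) := x.2

theorem range_fst : (fst q b).range = b.range.comap q := by
  ext x
  constructor
  · rintro ⟨y, rfl⟩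
    exact ⟨snd q b y, (condition q b y).symm⟩
  · rintro ⟨y, hy⟩
    exact ⟨⟨(x, y), hy.symm⟩, rfl⟩

theorem range_snd : (snd q b).range = q.range.comap b := by
  ext y
  constructor
  · rintro ⟨z, rfl⟩
    exact ⟨fst q b z, condition q b z⟩
  · rintro ⟨x, hx⟩
    exact ⟨⟨(x, y), hx⟩, rfl⟩

variable {q b} in
theorem exists_fst_eq_one (y : B) (hy : y ∈ b.ker) :
    ∃ x : fiberProduct q b, fst q b x = 1 ∧ snd q b x = y :=
  ⟨⟨(1, y), show q 1 = b y by rw [map_one, MonoidHom.mem_ker.1 hy]⟩, rfl, rfl⟩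

variable {q b} in
theorem exists_snd_eq_one (x : A) (hx : x ∈ q.ker) :
    ∃ y : fiberProduct q b, snd q b y = 1 ∧ fst q b y = x :=
  ⟨⟨(x, 1), show q x = b 1 by rw [map_one, MonoidHom.mem_ker.1 hx]⟩, rfl, rfl⟩

variable [TopologicalSpace A] [TopologicalSpace B] [TopologicalSpace X] [T2Space X]
  {q b}

theorem isClosed (hq : Continuous q) (hb : Continuous b) :
    IsClosed (fiberProduct q b : Set (A × B)) :=
  isClosed_eq (hq.comp continuous_fst) (hb.comp continuous_snd)

theorem isProperMap_val (hq : Continuous q) (hb : Continuous b) :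
    IsProperMap fun x : fiberProduct q b => (fst q b x, snd q b x) :=
  (isClosed hq hb).isClosedEmbedding_subtypeVal.isProperMap

theorem isProperMap_fst [T2Space A] [LocallyCompactSpace A] (hq : Continuous q)
    (hb : IsProperMap b) : IsProperMap (fst q b) := by
  have hv := isProperMap_val hq hb.continuous
  refine isProperMap_iff_isCompact_preimage.2 ⟨hv.continuous.fst, fun C hC => ?_⟩
  refine IsCompact.of_isClosed_subset
    (hv.isCompact_preimage (hC.prod (hb.isCompact_preimage (hC.image hq))))
    (hC.isClosed.preimage hv.continuous.fst) fun x hx => ⟨hx, fst q b x, hx, condition q b x⟩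

theorem isProperMap_snd [T2Space B] [LocallyCompactSpace B] (hq : IsProperMap q)
    (hb : Continuous b) : IsProperMap (snd q b) := by
  have hv := isProperMap_val hq.continuous hb
  refine isProperMap_iff_isCompact_preimage.2 ⟨hv.continuous.snd, fun C hC => ?_⟩
  refine IsCompact.of_isClosed_subset
    (hv.isCompact_preimage ((hq.isCompact_preimage (hC.image hb)).prod hC))
    (hC.isClosed.preimage hv.continuous.snd)
    fun x hx => ⟨⟨snd q b x, hx, (condition q b x).symm⟩, hx⟩

/-- The Haar measure of the fibre product, normalised by its image in one factor, has the expected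
image in the other factor: both constants can be read off after projecting further to `X`. -/
theorem exists_haar_map_eq
    [IsTopologicalGroup A] [T2Space A] [LocallyCompactSpace A] [SecondCountableTopology A]
    [MeasurableSpace A] [BorelSpace A]
    [IsTopologicalGroup B] [T2Space B] [LocallyCompactSpace B] [SecondCountableTopology B]
    [MeasurableSpace B] [BorelSpace B]
    [LocallyCompactSpace X] [MeasurableSpace X] [BorelSpace X]
    (ρ : Measure A) [ρ.IsHaarMeasure] (τ : Measure B) [τ.IsHaarMeasure]
    (ξ : Measure X) [ξ.IsHaarMeasure] (hq : IsProperMap q) (hb : IsProperMap b)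
    (hqo : IsOpen (q.range : Set X)) (hbo : IsOpen (b.range : Set X)) {β α : ℝ≥0} (hα : α ≠ 0)
    (hρ : ρ.map q = β • ξ.restrict (q.range : Set X))
    (hτ : τ.map b = α • ξ.restrict (b.range : Set X)) :
    ∃ π : Measure (fiberProduct q b), π.IsHaarMeasure ∧
      π.map (fst q b) = α • ρ.restrict (b.range.comap q : Set A) ∧
      π.map (snd q b) = β • τ.restrict (q.range.comap b : Set B) := by
  have hP : LocallyCompactSpace (fiberProduct q b) :=
    (isClosed hq.continuous hb.continuous).isClosedEmbedding_subtypeVal.locallyCompactSpace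
  have hu := isProperMap_fst hq.continuous hb
  have hv := isProperMap_snd hq hb.continuous
  have hqm := hq.continuous.measurable
  have hbm := hb.continuous.measurable
  have huo : IsOpen ((fst q b).range : Set A) := by
    rw [range_fst]; exact hbo.preimage hq.continuous
  have hvo : IsOpen ((snd q b).range : Set B) := by
    rw [range_snd]; exact hqo.preimage hb.continuous
  let π₀ : Measure (fiberProduct q b) := Measure.haar
  obtain ⟨c, hc, hc'⟩ := exists_map_eq_smul_restrict π₀ ρ (fst q b) hu huo
  let π := (α / c) • π₀
  have hπ : π.IsHaarMeasure := Measure.IsHaarMeasure.nnreal_smul _ (div_ne_zero hα hc)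
  have h1 : π.map (fst q b) = α • ρ.restrict (b.range.comap q : Set A) := by
    rw [Measure.map_smul, hc', smul_smul, div_mul_cancel₀ _ hc, range_fst]
  obtain ⟨d, hd, hd'⟩ := exists_map_eq_smul_restrict π τ (snd q b) hv hvo
  have e1 : (π.map (fst q b)).map q =
      (α * β) • ξ.restrict ((b.range ⊓ q.range : Subgroup X) : Set X) := by
    rw [h1, Measure.map_smul]
    have := Measure.restrict_map (μ := ρ) hqm hbo.measurableSet
    rw [Subgroup.coe_comap, ← this, hρ, Measure.restrict_smul,
      Measure.restrict_restrict hbo.measurableSet, smul_smul]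
    rfl
  have e2 : (π.map (snd q b)).map b =
      (d * α) • ξ.restrict ((b.range ⊓ q.range : Subgroup X) : Set X) := by
    rw [hd', Measure.map_smul, range_snd]
    have := Measure.restrict_map (μ := τ) hbm hqo.measurableSet
    rw [Subgroup.coe_comap, ← this, hτ, Measure.restrict_smul,
      Measure.restrict_restrict hqo.measurableSet, smul_smul, inf_comm]
    rfl
  have e3 : (π.map (fst q b)).map q = (π.map (snd q b)).map b := by
    rw [Measure.map_map hqm hu.continuous.measurable, Measure.map_map hbm hv.continuous.measurable]
    congr 1
    ext x
    exact condition q b x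
  have h4 := eq_of_smul_restrict_eq ξ (b.range ⊓ q.range) (hbo.inter hqo)
    (e1.symm.trans (e3.trans e2))
  have h5 : d = β := mul_right_cancel₀ hα (by rw [← h4, mul_comm])
  refine ⟨π, hπ, h1, ?_⟩
  rw [hd', h5, range_snd]

end fiberProduct

end FiberProduct

/-! ### Products of polyhomomorphisms -/

section Product

set_option linter.unusedSectionVars false

variable {G H K : Type*}
    [Group G] [TopologicalSpace G] [MeasurableSpace G]
    [Group H] [TopologicalSpace H] [MeasurableSpace H]
    [Group K] [TopologicalSpace K] [MeasurableSpace K]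
    {γ : Measure G} {η : Measure H} {κ : Measure K}

namespace MulRel

/-- The projection of a multiplicative relation `R ⊆ G × H` to `G`. -/
def fst (R : Subgroup (G × H)) : R →* G := (MonoidHom.fst G H).comp R.subtype

/-- The projection of a multiplicative relation `R ⊆ G × H` to `H`. -/
def snd (R : Subgroup (G × H)) : R →* H := (MonoidHom.snd G H).comp R.subtype

omit [TopologicalSpace G] [MeasurableSpace G] [TopologicalSpace H] [MeasurableSpace H]
  [TopologicalSpace K] [MeasurableSpace K]

theorem range_fst (R : Subgroup (G × H)) : (fst R).range = dom R := by
  rw [fst, MonoidHom.range_comp, R.range_subtype, dom]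

theorem range_snd (R : Subgroup (G × H)) : (snd R).range = im R := by
  rw [snd, MonoidHom.range_comp, R.range_subtype, im]

theorem map_snd_ker_fst (R : Subgroup (G × H)) : (fst R).ker.map (snd R) = indef R := by
  ext h
  constructor
  · rintro ⟨⟨⟨g, h⟩, hr⟩, hg : g = 1, rfl⟩
    subst hg
    exact hr
  · intro hr
    exact ⟨⟨(1, h), hr⟩, rfl, rfl⟩

theorem map_fst_ker_snd (R : Subgroup (G × H)) : (snd R).ker.map (fst R) = ker R := by
  ext g
  constructor
  · rintro ⟨⟨⟨g, h⟩, hr⟩, hg : h = 1, rfl⟩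
    subst hg
    exact hr
  · intro hr
    exact ⟨⟨(g, 1), hr⟩, rfl, rfl⟩

theorem map_fst_comap_dom (R : Subgroup (G × H)) (T : Subgroup (H × K)) :
    ((dom T).comap (snd R)).map (fst R) = dom (comp T R) := by
  ext g
  constructor
  · rintro ⟨⟨⟨g, h⟩, hr⟩, ⟨⟨h', k⟩, ht, hh : h' = h⟩, rfl⟩
    subst hh
    exact ⟨(g, k), ⟨h', hr, ht⟩, rfl⟩
  · rintro ⟨⟨g, k⟩, ⟨h, hr, ht⟩, rfl⟩
    exact ⟨⟨(g, h), hr⟩, ⟨(h, k), ht, rfl⟩, rfl⟩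

theorem map_snd_comap_im (R : Subgroup (G × H)) (T : Subgroup (H × K)) :
    ((im R).comap (fst T)).map (snd T) = im (comp T R) := by
  ext k
  constructor
  · rintro ⟨⟨⟨h, k⟩, ht⟩, ⟨⟨g, h'⟩, hr, hh : h' = h⟩, rfl⟩
    subst hh
    exact ⟨(g, k), ⟨h', hr, ht⟩, rfl⟩
  · rintro ⟨⟨g, k⟩, ⟨h, hr, ht⟩, rfl⟩
    exact ⟨⟨(h, k), ht⟩, ⟨(g, h), hr, rfl⟩, rfl⟩

/-- The projection of the fibre product of two relations onto their product. -/
def toComp (R : Subgroup (G × H)) (T : Subgroup (H × K)) :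
    fiberProduct (snd R) (fst T) →* comp T R :=
  (((fst R).comp (fiberProduct.fst _ _)).prod ((snd T).comp (fiberProduct.snd _ _))).codRestrict _
    fun x => ⟨snd R (fiberProduct.fst _ _ x), (fiberProduct.fst _ _ x).2, by
      have h := fiberProduct.condition (snd R) (fst T) x
      rw [h]
      exact (fiberProduct.snd _ _ x).2⟩

theorem toComp_surjective (R : Subgroup (G × H)) (T : Subgroup (H × K)) :
    Function.Surjective (toComp R T) := by
  rintro ⟨⟨g, k⟩, ⟨h, hr, ht⟩⟩
  exact ⟨⟨(⟨(g, h), hr⟩, ⟨(h, k), ht⟩), rfl⟩, rfl⟩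

end MulRel

namespace NonzeroPolh

variable (R : NonzeroPolh γ η) (T : NonzeroPolh η κ)

attribute [instance] NonzeroPolh.isHaar

theorem continuous_fst : Continuous (MulRel.fst R.rel) :=
  _root_.continuous_fst.comp continuous_subtype_val

theorem continuous_snd : Continuous (MulRel.snd R.rel) :=
  _root_.continuous_snd.comp continuous_subtype_val

variable
    [IsTopologicalGroup G] [T2Space G] [LocallyCompactSpace G]
    [SecondCountableTopology G] [BorelSpace G]
    [IsTopologicalGroup H] [T2Space H] [LocallyCompactSpace H]
    [SecondCountableTopology H] [BorelSpace H]
    [IsTopologicalGroup K] [T2Space K] [LocallyCompactSpace K]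
    [SecondCountableTopology K] [BorelSpace K]
    [γ.IsHaarMeasure] [η.IsHaarMeasure] [κ.IsHaarMeasure]

instance : LocallyCompactSpace R.rel :=
  R.isClosed.isClosedEmbedding_subtypeVal.locallyCompactSpace

instance : SecondCountableTopology R.rel :=
  TopologicalSpace.Subtype.secondCountableTopology (R.rel : Set (G × H))

theorem isProperMap_fst : IsProperMap (MulRel.fst R.rel) :=
  isProperMap_of_map_le R.haar γ _ R.continuous_fst R.map_fst_le

theorem isProperMap_snd : IsProperMap (MulRel.snd R.rel) :=
  isProperMap_of_map_le R.haar η _ R.continuous_snd R.map_snd_le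

theorem isOpen_dom : IsOpen (MulRel.dom R.rel : Set G) := by
  rw [← MulRel.range_fst]
  exact isOpen_range_of_map_le R.haar γ _ R.continuous_fst R.map_fst_le

theorem isOpen_im : IsOpen (MulRel.im R.rel : Set H) := by
  rw [← MulRel.range_snd]
  exact isOpen_range_of_map_le R.haar η _ R.continuous_snd R.map_snd_le

theorem exists_isAlpha : ∃ a : ℝ≥0, a ≠ 0 ∧ a ≤ 1 ∧ R.IsAlpha a := by
  obtain ⟨a, ha, h⟩ := exists_map_eq_smul_restrict R.haar γ _ R.isProperMap_fst
    (by rw [MulRel.range_fst]; exact R.isOpen_dom)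
  rw [MulRel.range_fst] at h
  refine ⟨a, ha, le_of_smul_restrict_le γ _ R.isOpen_dom ?_, h⟩
  rw [← h, one_smul]
  exact R.map_fst_le

theorem exists_isBeta : ∃ b : ℝ≥0, b ≠ 0 ∧ b ≤ 1 ∧ R.IsBeta b := by
  obtain ⟨b, hb, h⟩ := exists_map_eq_smul_restrict R.haar η _ R.isProperMap_snd
    (by rw [MulRel.range_snd]; exact R.isOpen_im)
  rw [MulRel.range_snd] at h
  refine ⟨b, hb, le_of_smul_restrict_le η _ R.isOpen_im ?_, h⟩
  rw [← h, one_smul]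
  exact R.map_snd_le

variable {R} in
theorem IsAlpha.unique {a a' : ℝ≥0} (h : R.IsAlpha a) (h' : R.IsAlpha a') : a = a' :=
  eq_of_smul_restrict_eq γ _ R.isOpen_dom (h.symm.trans h')

variable {R} in
theorem IsBeta.unique {b b' : ℝ≥0} (h : R.IsBeta b) (h' : R.IsBeta b') : b = b' :=
  eq_of_smul_restrict_eq η _ R.isOpen_im (h.symm.trans h')

/-- A nonzero polyhomomorphism is determined by its relation and the constant `α`. -/
theorem eq_of_rel_eq_of_isAlpha {R R' : NonzeroPolh γ η} (h : R.rel = R'.rel) {a : ℝ≥0}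
    (ha : R.IsAlpha a) (ha' : R'.IsAlpha a) : R = R' := by
  have hc := R.isProperMap_fst
  obtain ⟨a₁, ha₁, -, ha₁'⟩ := R.exists_isAlpha
  obtain rfl := ha.unique ha₁'
  have ho := R.isOpen_dom
  obtain ⟨rel, cl, ρ, hρ, h1, h2⟩ := R
  obtain ⟨rel', cl', ρ', hρ', h1', h2'⟩ := R'
  obtain rfl : rel = rel' := h
  congr
  have : LocallyCompactSpace rel := cl.isClosedEmbedding_subtypeVal.locallyCompactSpace
  have : SecondCountableTopology rel :=
    TopologicalSpace.Subtype.secondCountableTopology (rel : Set (G × H))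
  have e := Measure.isMulLeftInvariant_eq_smul ρ' ρ
  set c := Measure.haarScalarFactor ρ' ρ
  -- `ρ' = c ρ` have the same nonzero image in `G`, which forces `c = 1`.
  have e2 : a • γ.restrict (MulRel.dom rel : Set G) =
      (c * a) • γ.restrict (MulRel.dom rel : Set G) := by
    have h3 : ρ'.map (fun r : rel => (r : G × H).1) = a • γ.restrict (MulRel.dom rel : Set G) := ha'
    have h4 : ρ.map (fun r : rel => (r : G × H).1) = a • γ.restrict (MulRel.dom rel : Set G) := ha
    rw [mul_smul, ← h4, ← Measure.map_smul, ← e, h3, h4]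
  have e3 : a = c * a := eq_of_smul_restrict_eq γ _ ho e2
  have e4 : c = 1 := (mul_eq_right₀ ha₁).1 e3.symm
  rw [e, e4, one_smul]

theorem isProperMap_toComp :
    IsProperMap fun x => ((MulRel.toComp R.rel T.rel x : MulRel.comp T.rel R.rel) : G × K) :=
  (R.isProperMap_fst.prodMap T.isProperMap_snd).comp
    (fiberProduct.isProperMap_val R.continuous_snd T.continuous_fst)

theorem isClosed_comp : IsClosed (MulRel.comp T.rel R.rel : Set (G × K)) := by
  have := (isProperMap_toComp R T).isClosedMap.isClosed_range
  convert this using 1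
  rw [Set.range_comp' Subtype.val, (MulRel.toComp_surjective R.rel T.rel).range_eq,
    Set.image_univ, Subtype.range_coe]

/-- The product of nonzero polyhomomorphisms: its Haar measure is the image of a Haar measure `π`
of the fibre product of the two relations over `H`, normalised so that the images of `π` in the two
relations are the restrictions of `α(T) ρ` and `β(R) τ`. -/
theorem exists_isProduct :
    ∃ S : NonzeroPolh γ κ, R.IsProduct T S ∧
      ∃ (aT bR : ℝ≥0) (π : Measure (fiberProduct (MulRel.snd R.rel) (MulRel.fst T.rel))),
        T.IsAlpha aT ∧ R.IsBeta bR ∧ π.IsHaarMeasure ∧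
        π.map (fiberProduct.fst _ _) =
          aT • R.haar.restrict ((MulRel.dom T.rel).comap (MulRel.snd R.rel) : Set R.rel) ∧
        π.map (fiberProduct.snd _ _) =
          bR • T.haar.restrict ((MulRel.im R.rel).comap (MulRel.fst T.rel) : Set T.rel) ∧
        ∀ f : G × K → ℝ, Continuous f → ∫ s : S.rel, f s ∂S.haar =
          ∫ x, f (MulRel.toComp R.rel T.rel x : MulRel.comp T.rel R.rel) ∂π := by
  obtain ⟨aR, haR0, -, haR⟩ := R.exists_isAlpha
  obtain ⟨bR, hbR0, hbR1, hbR⟩ := R.exists_isBeta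
  obtain ⟨aT, haT0, haT1, haT⟩ := T.exists_isAlpha
  obtain ⟨bT, hbT0, -, hbT⟩ := T.exists_isBeta
  have hqo : IsOpen ((MulRel.snd R.rel).range : Set H) := by
    rw [MulRel.range_snd]; exact R.isOpen_im
  have hbo : IsOpen ((MulRel.fst T.rel).range : Set H) := by
    rw [MulRel.range_fst]; exact T.isOpen_dom
  obtain ⟨π, hπ, hπ1, hπ2⟩ := fiberProduct.exists_haar_map_eq R.haar T.haar η R.isProperMap_snd
    T.isProperMap_fst hqo hbo haT0 (by rw [MulRel.range_snd]; exact hbR)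
    (by rw [MulRel.range_fst]; exact haT)
  rw [MulRel.range_fst] at hπ1
  rw [MulRel.range_snd] at hπ2
  have hm1 : Measurable (fiberProduct.fst (MulRel.snd R.rel) (MulRel.fst T.rel)) :=
    (fiberProduct.isProperMap_val R.continuous_snd T.continuous_fst).continuous.fst.measurable
  have hm2 : Measurable (fiberProduct.snd (MulRel.snd R.rel) (MulRel.fst T.rel)) :=
    (fiberProduct.isProperMap_val R.continuous_snd T.continuous_fst).continuous.snd.measurable
  have hw := isProperMap_toComp R T
  have hwc : Continuous (MulRel.toComp R.rel T.rel) := hw.continuous.subtype_mk _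
  have hwp : IsProperMap (MulRel.toComp R.rel T.rel) :=
    isProperMap_of_comp_of_inj hwc continuous_subtype_val hw Subtype.val_injective
  have hcl := isClosed_comp R T
  have : LocallyCompactSpace (MulRel.comp T.rel R.rel) :=
    hcl.isClosedEmbedding_subtypeVal.locallyCompactSpace
  have : LocallyCompactSpace (fiberProduct (MulRel.snd R.rel) (MulRel.fst T.rel)) :=
    (fiberProduct.isClosed R.continuous_snd
      T.continuous_fst).isClosedEmbedding_subtypeVal.locallyCompactSpace
  let σ : Measure (MulRel.comp T.rel R.rel) := π.map (MulRel.toComp R.rel T.rel)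
  have hσ : σ.IsHaarMeasure := Measure.isHaarMeasure_map π _ hwc
    (MulRel.toComp_surjective R.rel T.rel) (isProperMap_iff_tendsto_cocompact.1 hwp).2
  have hfm : Measurable fun s : MulRel.comp T.rel R.rel => (s : G × K).1 :=
    (_root_.continuous_fst.comp continuous_subtype_val).measurable
  have hsm : Measurable fun s : MulRel.comp T.rel R.rel => (s : G × K).2 :=
    (_root_.continuous_snd.comp continuous_subtype_val).measurable
  have hσ1 : σ.map (fun s : MulRel.comp T.rel R.rel => (s : G × K).1) =
      aT • (R.haar.restrict
      ((MulRel.dom T.rel).comap (MulRel.snd R.rel) : Set R.rel)).map (MulRel.fst R.rel) := by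
    rw [Measure.map_map hfm hwc.measurable, ← Measure.map_smul, ← hπ1,
      Measure.map_map R.continuous_fst.measurable hm1]
    rfl
  have hσ2 : σ.map (fun s : MulRel.comp T.rel R.rel => (s : G × K).2) =
      bR • (T.haar.restrict
      ((MulRel.im R.rel).comap (MulRel.fst T.rel) : Set T.rel)).map (MulRel.snd T.rel) := by
    rw [Measure.map_map hsm hwc.measurable, ← Measure.map_smul, ← hπ2,
      Measure.map_map T.continuous_snd.measurable hm2]
    rfl
  have hle1 : σ.map (fun s : MulRel.comp T.rel R.rel => (s : G × K).1) ≤ γ := by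
    rw [hσ1]
    intro s
    rw [Measure.smul_apply]
    refine (mul_le_of_le_one_left' (by exact_mod_cast haT1)).trans ?_
    exact (Measure.map_mono Measure.restrict_le_self R.continuous_fst.measurable s).trans
      (R.map_fst_le s)
  have hle2 : σ.map (fun s : MulRel.comp T.rel R.rel => (s : G × K).2) ≤ κ := by
    rw [hσ2]
    intro s
    rw [Measure.smul_apply]
    refine (mul_le_of_le_one_left' (by exact_mod_cast hbR1)).trans ?_
    exact (Measure.map_mono Measure.restrict_le_self T.continuous_snd.measurable s).trans
      (T.map_snd_le s)
  let S : NonzeroPolh γ κ := ⟨MulRel.comp T.rel R.rel, hcl, σ, hσ, hle1, hle2⟩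
  -- `dom (TR)` and `im (TR)` are open because the domination of `σ` makes `S` a polyhomomorphism.
  have hR' : IsOpen ((MulRel.dom T.rel).comap (MulRel.snd R.rel) : Set R.rel) :=
    T.isOpen_dom.preimage R.continuous_snd
  have hT' : IsOpen ((MulRel.im R.rel).comap (MulRel.fst T.rel) : Set T.rel) :=
    R.isOpen_im.preimage T.continuous_fst
  have hα := (map_restrict_eq_smul_restrict R.haar γ (MulRel.fst R.rel) R.isProperMap_fst aR
    (by rw [MulRel.range_fst]; exact haR) _ hR'
    (by rw [MulRel.map_fst_comap_dom]; exact S.isOpen_dom)).2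
  have hβ := (map_restrict_eq_smul_restrict T.haar κ (MulRel.snd T.rel) T.isProperMap_snd bT
    (by rw [MulRel.range_snd]; exact hbT) _ hT'
    (by rw [MulRel.map_snd_comap_im]; exact S.isOpen_im)).2
  rw [Subgroup.relIndex_comap, MulRel.map_snd_ker_fst, MulRel.map_fst_comap_dom] at hα
  rw [Subgroup.relIndex_comap, MulRel.map_fst_ker_snd, MulRel.map_snd_comap_im] at hβ
  refine ⟨S, ⟨rfl, aR, bR, aT, bT, _, _, haR, hbR, haT, hbT, ?_, ?_, rfl, rfl⟩,
    aT, bR, π, haT, hbR, hπ, hπ1, hπ2, fun f hf => ?_⟩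
  · refine hσ1.trans ?_
    rw [hα, smul_smul, ← mul_div_assoc, mul_comm aT]
  · refine hσ2.trans ?_
    rw [hβ, smul_smul, ← mul_div_assoc]
  · exact integral_map hwc.measurable.aemeasurable
      (hf.comp continuous_subtype_val).aestronglyMeasurable

theorem IsProduct.unique {R : NonzeroPolh γ η} {T : NonzeroPolh η κ} {S S' : NonzeroPolh γ κ}
    (h : R.IsProduct T S) (h' : R.IsProduct T S') : S = S' := by
  obtain ⟨hS, aR, bR, aT, bT, aS, bS, haR, -, haT, -, haS, -, e, -⟩ := h
  obtain ⟨hS', aR', bR', aT', bT', aS', bS', haR', -, haT', -, haS', -, e', -⟩ := h'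
  obtain rfl := haR.unique haR'
  obtain rfl := haT.unique haT'
  obtain rfl := e.trans e'.symm
  exact eq_of_rel_eq_of_isAlpha (hS.trans hS'.symm) haS haS'

end NonzeroPolh

end Product

/-! ### Separate continuity of the product -/

theorem exists_isProbabilityMeasure_isMulRightInvariant (N : Type*) [Group N] [TopologicalSpace N]
    [IsTopologicalGroup N] [CompactSpace N] [MeasurableSpace N] [BorelSpace N] :
    ∃ ν : Measure N, IsProbabilityMeasure ν ∧ ν.IsMulRightInvariant := by
  refine ⟨(Measure.haarMeasure ⊤).inv, ⟨?_⟩, inferInstance⟩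
  rw [Measure.inv_apply, Set.inv_univ]
  exact Measure.haarMeasure_self

/-- The pullback of a compactly supported continuous function under a proper map. -/
def CompactlySupportedContinuousMap.compProper {X Y : Type*} [TopologicalSpace X]
    [T2Space X] [TopologicalSpace Y] (f : C_c(Y, ℝ)) (p : X → Y) (hp : IsProperMap p) :
    C_c(X, ℝ) where
  toFun := f ∘ p
  continuous_toFun := f.continuous.comp hp.continuous
  hasCompactSupport' := HasCompactSupport.intro (hp.isCompact_preimage f.hasCompactSupport)
    fun x hx => show f (p x) = 0 from image_eq_zero_of_notMem_tsupport hx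

section Continuity

set_option linter.unusedSectionVars false

variable {G H K : Type*}
    [Group G] [TopologicalSpace G] [MeasurableSpace G]
    [Group H] [TopologicalSpace H] [MeasurableSpace H]
    [Group K] [TopologicalSpace K] [MeasurableSpace K]
    {γ : Measure G} {η : Measure H} {κ : Measure K}
    [IsTopologicalGroup G] [T2Space G] [LocallyCompactSpace G]
    [SecondCountableTopology G] [BorelSpace G]
    [IsTopologicalGroup H] [T2Space H] [LocallyCompactSpace H]
    [SecondCountableTopology H] [BorelSpace H]
    [IsTopologicalGroup K] [T2Space K] [LocallyCompactSpace K]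
    [SecondCountableTopology K] [BorelSpace K]
    [γ.IsHaarMeasure] [η.IsHaarMeasure] [κ.IsHaarMeasure]

namespace NonzeroPolh

/-- Integrals against `TR` with the factor `χ` on `K` are integrals against `R`, with `χ` replaced
by its conditional expectation `χ'` along `T`. -/
theorem exists_integral_eq_left (T : NonzeroPolh η κ) (χ : C_c(K, ℝ)) :
    ∃ χ' : C_c(H, ℝ), ∀ (R : NonzeroPolh γ η) (S : NonzeroPolh γ κ), R.IsProduct T S →
      ∀ φ : C_c(G, ℝ), Polh.integral φ χ (.of S) = Polh.integral φ χ' (.of R) := by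
  obtain ⟨aT, -, -, haT⟩ := T.exists_isAlpha
  have : CompactSpace (MulRel.fst T.rel).ker :=
    isCompact_iff_compactSpace.1 (isCompact_ker_of_isProperMap _ T.isProperMap_fst)
  obtain ⟨ν, hν, hν'⟩ :=
    exists_isProbabilityMeasure_isMulRightInvariant (MulRel.fst T.rel).ker
  obtain ⟨f', hf', hf'0⟩ := exists_average (MulRel.fst T.rel) T.isProperMap_fst
    (by rw [MulRel.range_fst]; exact T.isOpen_dom) ν (χ.compProper _ T.isProperMap_snd)
  rw [MulRel.range_fst] at hf'0
  refine ⟨aT • f', fun R S hS φ => ?_⟩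
  obtain ⟨S', hS', aT', bR, π, haT', -, hπ, hπ1, -, hint⟩ := exists_isProduct R T
  obtain rfl := hS.unique hS'
  obtain rfl := haT.unique haT'
  have : LocallyCompactSpace (fiberProduct (MulRel.snd R.rel) (MulRel.fst T.rel)) :=
    (fiberProduct.isClosed R.continuous_snd
      T.continuous_fst).isClosedEmbedding_subtypeVal.locallyCompactSpace
  have : SecondCountableTopology (fiberProduct (MulRel.snd R.rel) (MulRel.fst T.rel)) :=
    TopologicalSpace.Subtype.secondCountableTopology _
  have hP := fiberProduct.isProperMap_val R.continuous_snd T.continuous_fst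
  have key := integral_mul_eq_integral_mul_average π (fiberProduct.fst _ _) (fiberProduct.snd _ _)
    hP (MulRel.snd R.rel) (MulRel.fst T.rel) T.isProperMap_fst
    (fun x => (fiberProduct.condition _ _ x).symm)
    fiberProduct.exists_fst_eq_one
    ν (φ.compProper _ R.isProperMap_fst) (χ.compProper _ T.isProperMap_snd) f' hf'
  have h1 : Polh.integral φ χ (.of S) = ∫ x : fiberProduct (MulRel.snd R.rel) (MulRel.fst T.rel),
      (φ.compProper _ R.isProperMap_fst) (fiberProduct.fst _ _ x) *
        (χ.compProper _ T.isProperMap_snd) (fiberProduct.snd _ _ x) ∂π :=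
    hint (fun p => φ p.1 * χ p.2) ((φ.continuous.comp _root_.continuous_fst).mul
      (χ.continuous.comp _root_.continuous_snd))
  have hc : Continuous fun r : R.rel =>
      (φ.compProper _ R.isProperMap_fst) r * f' (MulRel.snd R.rel r) :=
    (φ.compProper _ R.isProperMap_fst).continuous.mul (f'.continuous.comp R.continuous_snd)
  have h2 := integral_map (μ := π) hP.continuous.fst.measurable.aemeasurable
    hc.aestronglyMeasurable
  rw [h1, key, ← h2, hπ1, integral_smul_nnreal_measure,
    setIntegral_eq_integral_of_forall_compl_eq_zero]
  · rw [NNReal.smul_def, smul_eq_mul, ← integral_const_mul]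
    refine integral_congr_ae (ae_of_all _ fun r => ?_)
    exact mul_left_comm (aT : ℝ) (φ (r : G × H).1) (f' (r : G × H).2)
  · intro r hr
    rw [hf'0 _ hr, mul_zero]

/-- Integrals against `TR` with the factor `φ` on `G` are integrals against `T`, with `φ` replaced
by its conditional expectation `φ'` along `R`. -/
theorem exists_integral_eq_right (R : NonzeroPolh γ η) (φ : C_c(G, ℝ)) :
    ∃ φ' : C_c(H, ℝ), ∀ (T : NonzeroPolh η κ) (S : NonzeroPolh γ κ), R.IsProduct T S →
      ∀ χ : C_c(K, ℝ), Polh.integral φ χ (.of S) = Polh.integral φ' χ (.of T) := by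
  obtain ⟨bR, -, -, hbR⟩ := R.exists_isBeta
  have : CompactSpace (MulRel.snd R.rel).ker :=
    isCompact_iff_compactSpace.1 (isCompact_ker_of_isProperMap _ R.isProperMap_snd)
  obtain ⟨ν, hν, hν'⟩ :=
    exists_isProbabilityMeasure_isMulRightInvariant (MulRel.snd R.rel).ker
  obtain ⟨f', hf', hf'0⟩ := exists_average (MulRel.snd R.rel) R.isProperMap_snd
    (by rw [MulRel.range_snd]; exact R.isOpen_im) ν (φ.compProper _ R.isProperMap_fst)
  rw [MulRel.range_snd] at hf'0
  refine ⟨bR • f', fun T S hS χ => ?_⟩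
  obtain ⟨S', hS', aT, bR', π, -, hbR', hπ, -, hπ2, hint⟩ := exists_isProduct R T
  obtain rfl := hS.unique hS'
  obtain rfl := hbR.unique hbR'
  have : LocallyCompactSpace (fiberProduct (MulRel.snd R.rel) (MulRel.fst T.rel)) :=
    (fiberProduct.isClosed R.continuous_snd
      T.continuous_fst).isClosedEmbedding_subtypeVal.locallyCompactSpace
  have : SecondCountableTopology (fiberProduct (MulRel.snd R.rel) (MulRel.fst T.rel)) :=
    TopologicalSpace.Subtype.secondCountableTopology _
  have hP := fiberProduct.isProperMap_val R.continuous_snd T.continuous_fst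
  have key := integral_mul_eq_integral_mul_average π (fiberProduct.snd _ _) (fiberProduct.fst _ _)
    ((Homeomorph.prodComm _ _).isProperMap.comp hP) (MulRel.fst T.rel) (MulRel.snd R.rel)
    R.isProperMap_snd (fun x => fiberProduct.condition _ _ x)
    fiberProduct.exists_snd_eq_one
    ν (χ.compProper _ T.isProperMap_snd) (φ.compProper _ R.isProperMap_fst) f' hf'
  have h1 : Polh.integral φ χ (.of S) = ∫ x : fiberProduct (MulRel.snd R.rel) (MulRel.fst T.rel),
      (χ.compProper _ T.isProperMap_snd) (fiberProduct.snd _ _ x) *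
        (φ.compProper _ R.isProperMap_fst) (fiberProduct.fst _ _ x) ∂π := by
    refine (hint (fun p => φ p.1 * χ p.2) ((φ.continuous.comp _root_.continuous_fst).mul
      (χ.continuous.comp _root_.continuous_snd))).trans ?_
    exact integral_congr_ae (ae_of_all _ fun x => mul_comm _ _)
  have hc : Continuous fun t : T.rel =>
      (χ.compProper _ T.isProperMap_snd) t * f' (MulRel.fst T.rel t) :=
    (χ.compProper _ T.isProperMap_snd).continuous.mul (f'.continuous.comp T.continuous_fst)
  have h2 := integral_map (μ := π) hP.continuous.snd.measurable.aemeasurable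
    hc.aestronglyMeasurable
  rw [h1, key, ← h2, hπ2, integral_smul_nnreal_measure,
    setIntegral_eq_integral_of_forall_compl_eq_zero]
  · rw [NNReal.smul_def, smul_eq_mul, ← integral_const_mul]
    refine integral_congr_ae (ae_of_all _ fun t => ?_)
    change (bR : ℝ) * (χ (t : H × K).2 * f' (t : H × K).1) =
      ((bR : ℝ) * f' (t : H × K).1) * χ (t : H × K).2
    ring
  · intro t ht
    rw [hf'0 _ ht, mul_zero]

end NonzeroPolh

namespace Polh

theorem exists_isProduct (R : Polh γ η) (T : Polh η κ) : ∃ S : Polh γ κ, IsProduct R T S := by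
  cases R with
  | zero => exact ⟨.zero, rfl⟩
  | of R =>
    cases T with
    | zero => exact ⟨.zero, rfl⟩
    | of T =>
      obtain ⟨S, hS, -⟩ := NonzeroPolh.exists_isProduct R T
      exact ⟨.of S, hS⟩

theorem isProduct_mul (R : Polh γ η) (T : Polh η κ) : IsProduct R T (T.mul R) := by
  have h := exists_isProduct R T
  rw [mul, dif_pos h]
  exact h.choose_spec

theorem IsProduct.unique {R : Polh γ η} {T : Polh η κ} {S S' : Polh γ κ}
    (h : IsProduct R T S) (h' : IsProduct R T S') : S = S' := by
  cases R with
  | zero => exact Eq.trans (b := Polh.zero) h h'.symm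
  | of R =>
    cases T with
    | zero => exact Eq.trans (b := Polh.zero) h h'.symm
    | of T =>
      cases S with
      | zero => exact h.elim
      | of S =>
        cases S' with
        | zero => exact h'.elim
        | of S' => exact congrArg _ (NonzeroPolh.IsProduct.unique h h')

theorem mul_zero (T : Polh η κ) : T.mul (zero : Polh γ η) = zero := isProduct_mul zero T

theorem zero_mul (R : Polh γ η) : (zero : Polh η κ).mul R = zero := by
  cases R with
  | zero => exact mul_zero _
  | of R => exact isProduct_mul (of R) zero

theorem exists_of_mul_of (R : NonzeroPolh γ η) (T : NonzeroPolh η κ) :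
    ∃ S, R.IsProduct T S ∧ (of T).mul (of R) = of S := by
  obtain ⟨S, hS, -⟩ := NonzeroPolh.exists_isProduct R T
  exact ⟨S, hS, (isProduct_mul (of R) (of T)).unique hS⟩

theorem continuous_integral (φ : C_c(G, ℝ)) (ψ : C_c(H, ℝ)) :
    Continuous (integral φ ψ : Polh γ η → ℝ) :=
  continuous_iff_continuousAt.2 fun _ => tendsto_iff.1 Filter.tendsto_id φ ψ

theorem continuous_iff {Y : Type*} [TopologicalSpace Y] {F : Y → Polh γ η} :
    Continuous F ↔ ∀ φ ψ, Continuous fun y => integral φ ψ (F y) := by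
  refine ⟨fun h φ ψ => (continuous_integral φ ψ).comp h, fun h => ?_⟩
  exact continuous_iff_continuousAt.2 fun y => tendsto_iff.2 fun φ ψ => (h φ ψ).continuousAt

theorem continuous_mul_left (T : Polh η κ) : Continuous fun R : Polh γ η => T.mul R := by
  cases T with
  | zero => simpa only [zero_mul] using continuous_const
  | of T =>
    refine continuous_iff.2 fun φ χ => ?_
    obtain ⟨χ', hχ'⟩ := T.exists_integral_eq_left (γ := γ) χ
    refine (continuous_integral φ χ').congr fun R => ?_
    cases R with
    | zero => rw [mul_zero]; rfl
    | of R =>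
      obtain ⟨S, hS, hS'⟩ := exists_of_mul_of R T
      rw [hS', hχ' R S hS]

theorem continuous_mul_right (R : Polh γ η) : Continuous fun T : Polh η κ => T.mul R := by
  cases R with
  | zero => simpa only [mul_zero] using continuous_const
  | of R =>
    refine continuous_iff.2 fun φ χ => ?_
    obtain ⟨φ', hφ'⟩ := R.exists_integral_eq_right (κ := κ) φ
    refine (continuous_integral φ' χ).congr fun T => ?_
    cases T with
    | zero => rw [zero_mul]; rfl
    | of T =>
      obtain ⟨S, hS, hS'⟩ := exists_of_mul_of R T
      rw [hS', hφ' T S hS]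

end Polh

end Continuity

/-! ### Vague limits of measures -/

section VagueLimit

/-- Urysohn's lemma for compactly supported functions. -/
theorem exists_compactlySupported_of_isCompact_subset_isOpen {X : Type*} [TopologicalSpace X]
    [R1Space X] [LocallyCompactSpace X] {C U : Set X} (hC : IsCompact C) (hU : IsOpen U)
    (h : C ⊆ U) :
    ∃ f : C_c(X, ℝ), Set.EqOn f 1 C ∧ tsupport f ⊆ U ∧ ∀ x, f x ∈ Set.Icc 0 1 := by
  obtain ⟨f, h1, h2, h3, h4⟩ := exists_continuousMap_one_of_isCompact_subset_isOpen hC hU h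
  exact ⟨⟨f, h2⟩, h1, h3, h4⟩

variable {ι : Type*} {l : Filter ι} [l.NeBot]

/-- Domination of image measures passes to vague limits. -/
theorem map_le_of_forall_tendsto_integral {X Y : Type*} [TopologicalSpace X] [T2Space X]
    [LocallyCompactSpace X] [MeasurableSpace X] [BorelSpace X] [TopologicalSpace Y]
    [MeasurableSpace Y] [BorelSpace Y] {μs : ι → Measure X} {μ : Measure X} [μ.Regular]
    [∀ i, IsFiniteMeasureOnCompacts (μs i)]
    (h : ∀ f : C_c(X, ℝ), Filter.Tendsto (fun i => ∫ x, f x ∂μs i) l (𝓝 (∫ x, f x ∂μ)))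
    {p : X → Y} (hp : Continuous p) (ξ : Measure Y) [ξ.OuterRegular]
    (hle : ∀ i, (μs i).map p ≤ ξ) : μ.map p ≤ ξ := by
  have hopen : ∀ U : Set Y, IsOpen U → μ (p ⁻¹' U) ≤ ξ U := by
    intro U hU
    by_cases hfin : ξ U = ⊤
    · rw [hfin]; exact le_top
    rw [(hU.preimage hp).measure_eq_iSup_isCompact]
    refine iSup₂_le fun C hCU => iSup_le fun hC => ?_
    obtain ⟨f, hf1, hfU, hf⟩ :=
      exists_compactlySupported_of_isCompact_subset_isOpen hC (hU.preimage hp) hCU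
    have hb : ∀ i, ∫ x, f x ∂μs i ≤ ξ.real U := by
      intro i
      have hi : μs i (p ⁻¹' U) ≤ ξ U := by
        rw [← Measure.map_apply hp.measurable hU.measurableSet]
        exact hle i U
      have hUm : MeasurableSet (p ⁻¹' U) := (hU.preimage hp).measurableSet
      calc ∫ x, f x ∂μs i ≤ ∫ x, (p ⁻¹' U).indicator 1 x ∂μs i := by
            refine integral_mono f.integrable ?_ fun x => ?_
            · exact (integrable_indicator_iff hUm).2
                (integrableOn_const (ne_top_of_le_ne_top hfin hi))
            · by_cases hx : x ∈ tsupport f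
              · simp [hfU hx, (hf x).2]
              · rw [image_eq_zero_of_notMem_tsupport hx]
                exact Set.indicator_nonneg (fun _ _ => zero_le_one) x
        _ = (μs i).real (p ⁻¹' U) := integral_indicator_one hUm
        _ ≤ ξ.real U := ENNReal.toReal_mono hfin hi
    have hlim : ∫ x, f x ∂μ ≤ ξ.real U := le_of_tendsto (h f) (Filter.Eventually.of_forall hb)
    have hCf : μ.real C ≤ ∫ x, f x ∂μ := by
      rw [← integral_indicator_one hC.measurableSet]
      refine integral_mono ((integrable_indicator_iff hC.measurableSet).2
        (integrableOn_const hC.measure_lt_top.ne)) f.integrable fun x => ?_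
      by_cases hx : x ∈ C
      · simp [hx, hf1 hx]
      · simp [hx, (hf x).1]
    exact (ENNReal.toReal_le_toReal hC.measure_lt_top.ne hfin).1 (hCf.trans hlim)
  refine Measure.le_iff.2 fun s hs => ?_
  rw [s.measure_eq_iInf_isOpen ξ]
  refine le_iInf₂ fun U hsU => le_iInf fun hU => ?_
  refine (measure_mono hsU).trans ?_
  rw [Measure.map_apply hp.measurable hU.measurableSet]
  exact hopen U hU

open Pointwise in
/-- If each `μs i` is invariant under translation by every point of its support, then so is the
vague limit `μ`: a point of the support of `μ` is approximated by points of the supports of the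
`μs i`. -/
theorem map_mul_left_eq_self_of_forall_tendsto_integral {X : Type*} [Group X] [TopologicalSpace X]
    [IsTopologicalGroup X] [T2Space X] [LocallyCompactSpace X] [SecondCountableTopology X]
    [MeasurableSpace X] [BorelSpace X] {μs : ι → Measure X} {μ : Measure X} [μ.Regular]
    [∀ i, IsFiniteMeasureOnCompacts (μs i)]
    (h : ∀ f : C_c(X, ℝ), Filter.Tendsto (fun i => ∫ x, f x ∂μs i) l (𝓝 (∫ x, f x ∂μ)))
    (hbdd : ∀ C : Set X, IsCompact C → ∃ M : ℝ, ∀ i, (μs i).real C ≤ M)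
    (hinv : ∀ i, ∀ x ∈ (μs i).support, (μs i).map (x * ·) = μs i) {x : X} (hx : x ∈ μ.support) :
    μ.map (x * ·) = μ := by
  have hreg : (μ.map (x * ·)).Regular := Measure.Regular.map (Homeomorph.mulLeft x)
  refine Measure.ext_of_integral_eq_on_compactlySupported fun f => ?_
  have hfm : ∀ (y : X) (ν : Measure X), ∫ z, f z ∂(ν.map (y * ·)) = ∫ z, f (y * z) ∂ν :=
    fun y ν => integral_map (measurable_const_mul y).aemeasurable
      f.continuous.aestronglyMeasurable
  rw [hfm]
  obtain ⟨V, hV, hxV⟩ := exists_compact_mem_nhds x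
  -- `C` contains every `z` with `f (y * z) ≠ 0` for some `y` near `x`.
  let C : Set X := V⁻¹ * tsupport f
  have hC : IsCompact C := hV.inv.mul f.hasCompactSupport
  have hfC : ∀ y ∈ V, ∀ z ∉ C, f (y * z) = 0 := by
    intro y hy z hz
    refine image_eq_zero_of_notMem_tsupport fun hyz => hz ?_
    exact ⟨y⁻¹, Set.inv_mem_inv.2 hy, y * z, hyz, by simp⟩
  obtain ⟨M, hM⟩ := hbdd C hC
  let fx : ∀ y : X, C_c(X, ℝ) := fun y => f.compProper (y * ·) (Homeomorph.mulLeft y).isProperMap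
  have hlim : Filter.Tendsto (fun i => ‖∫ z, f (x * z) ∂μs i - ∫ z, f z ∂μs i‖) l
      (𝓝 ‖∫ z, f (x * z) ∂μ - ∫ z, f z ∂μ‖) := ((h (fx x)).sub (h f)).norm
  have key : ∀ ε > 0, ‖∫ z, f (x * z) ∂μ - ∫ z, f z ∂μ‖ ≤ ε * M := by
    intro ε hε
    obtain ⟨v, hv, hvε⟩ := hC.mem_uniformity_of_prod (f := fun y z => f (y * z)) (s := Set.univ)
      (q := x) (Continuous.continuousOn (by
        have := f.continuous
        unfold Function.uncurry
        fun_prop)) trivial (Metric.dist_mem_uniformity hε)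
    rw [nhdsWithin_univ] at hv
    have hU : v ∩ V ∈ 𝓝 x := Filter.inter_mem hv hxV
    obtain ⟨a, ha1, haU, ha⟩ := exists_compactlySupported_of_isCompact_subset_isOpen
      (isCompact_singleton (x := x)) isOpen_interior
      (Set.singleton_subset_iff.2 (mem_interior_iff_mem_nhds.2 hU))
    have hapos : ∀ (ν : Measure X) [IsFiniteMeasureOnCompacts ν],
        0 < ∫ z, a z ∂ν ↔ 0 < ν (Function.support a) := fun ν _ =>
      integral_pos_iff_support_of_nonneg (fun z => (ha z).1) a.integrable
    have hpos : 0 < ∫ z, a z ∂μ := by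
      rw [hapos]
      refine (Measure.mem_support_iff_forall x).1 hx _ ?_
      refine (a.continuous.isOpen_support).mem_nhds ?_
      simp [ha1 (Set.mem_singleton x)]
    refine le_of_tendsto hlim ?_
    filter_upwards [(h a).eventually_const_lt hpos] with i hi
    -- A point `y` of the support of `μs i` close to `x`, at which translation invariance is known.
    obtain ⟨y, hya, hy⟩ := Measure.nonempty_inter_support_of_pos ((hapos (μs i)).1 hi)
    have hyU : y ∈ v ∩ V := interior_subset (haU (subset_tsupport a hya))
    have h1 : ∫ z, f z ∂μs i = ∫ z, f (y * z) ∂μs i := by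
      conv_lhs => rw [← hinv i y hy]
      exact hfm y _
    have h2 : ∫ z, f (x * z) ∂μs i - ∫ z, f (y * z) ∂μs i =
        ∫ z, (f (x * z) - f (y * z)) ∂μs i :=
      (integral_sub (fx x).integrable (fx y).integrable).symm
    rw [h1, h2, ← setIntegral_eq_integral_of_forall_compl_eq_zero (s := C)]
    · refine (norm_setIntegral_le_of_norm_le_const (C := ε) hC.measure_lt_top ?_).trans
        (mul_le_mul_of_nonneg_left (hM i) hε.le)
      intro z hz
      have := hvε y hyU.1 z hz
      rw [← dist_eq_norm, dist_comm]
      exact le_of_lt this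
    · intro z hz
      rw [hfC x (mem_of_mem_nhds hxV) z hz, hfC y hyU.2 z hz, sub_zero]
  have hle : ‖∫ z, f (x * z) ∂μ - ∫ z, f z ∂μ‖ ≤ 0 := by
    refine ge_of_tendsto (x := 𝓝[>] (0 : ℝ)) (f := fun ε : ℝ => ε * M) ?_ ?_
    · have : Filter.Tendsto (fun ε : ℝ => ε * M) (𝓝 0) (𝓝 (0 * M)) :=
        (continuous_id.mul continuous_const).tendsto 0
      rw [zero_mul] at this
      exact this.mono_left nhdsWithin_le_nhds
    · filter_upwards [self_mem_nhdsWithin] with ε hε using key ε hε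
  exact sub_eq_zero.1 (norm_le_zero_iff.1 hle)

/-- Vague compactness: along an ultrafilter, measures that are uniformly bounded on compact sets
converge against all compactly supported continuous functions. The limit functional is
represented by a measure through the Riesz–Markov–Kakutani theorem. -/
theorem exists_forall_tendsto_integral {X : Type*} [TopologicalSpace X] [T2Space X]
    [LocallyCompactSpace X] [MeasurableSpace X] [BorelSpace X] (𝓕 : Ultrafilter ι)
    {μs : ι → Measure X} [∀ i, IsFiniteMeasureOnCompacts (μs i)]
    (hbdd : ∀ C : Set X, IsCompact C → ∃ M : ℝ, ∀ i, (μs i).real C ≤ M) :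
    ∃ μ : Measure X, μ.Regular ∧ ∀ f : C_c(X, ℝ),
      Filter.Tendsto (fun i => ∫ x, f x ∂μs i) 𝓕 (𝓝 (∫ x, f x ∂μ)) := by
  have hex : ∀ f : C_c(X, ℝ), ∃ c : ℝ, Filter.Tendsto (fun i => ∫ x, f x ∂μs i) 𝓕 (𝓝 c) := by
    intro f
    obtain ⟨M, hM⟩ := hbdd _ f.hasCompactSupport
    obtain ⟨B, hB⟩ := f.hasCompactSupport.isCompact.exists_bound_of_continuousOn
      f.continuous.continuousOn
    have hb : ∀ i, ∫ x, f x ∂μs i ∈ Metric.closedBall (0 : ℝ) (|B| * M) := by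
      intro i
      rw [mem_closedBall_zero_iff, ← setIntegral_eq_integral_of_forall_compl_eq_zero
        (s := tsupport f) fun x hx => image_eq_zero_of_notMem_tsupport hx]
      exact (norm_setIntegral_le_of_norm_le_const f.hasCompactSupport.isCompact.measure_lt_top
        fun x hx => (hB x hx).trans (le_abs_self B)).trans
        (mul_le_mul_of_nonneg_left (hM i) (abs_nonneg B))
    obtain ⟨c, -, hc⟩ := (isCompact_closedBall (0 : ℝ) (|B| * M)).ultrafilter_le_nhds
      (𝓕.map fun i => ∫ x, f x ∂μs i)
      (Filter.le_principal_iff.2 (Filter.mem_map.2 (Filter.univ_mem' hb)))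
    exact ⟨c, hc⟩
  choose Λ hΛ using hex
  let Λ' : C_c(X, ℝ) →ₗ[ℝ] ℝ :=
    { toFun := Λ
      map_add' := fun f g => by
        refine tendsto_nhds_unique (hΛ (f + g)) (((hΛ f).add (hΛ g)).congr fun i => ?_)
        exact (integral_add f.integrable g.integrable).symm
      map_smul' := fun c f => by
        refine tendsto_nhds_unique (hΛ (c • f)) (((hΛ f).const_smul c).congr fun i => ?_)
        exact (integral_smul c f).symm }
  have hpos : ∀ f : C_c(X, ℝ), 0 ≤ f → 0 ≤ Λ' f := fun f hf =>
    ge_of_tendsto' (hΛ f) fun i => integral_nonneg hf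
  refine ⟨RealRMK.rieszMeasure (PositiveLinearMap.mk₀ Λ' hpos), inferInstance, fun f => ?_⟩
  rw [RealRMK.integral_rieszMeasure]
  exact hΛ f

end VagueLimit

/-! ### Countable determining families -/

section Determining

/-- The indicator of an open set is a pointwise limit of compactly supported functions below it. -/
theorem exists_seq_tendsto_indicator {X : Type*} [TopologicalSpace X] [T2Space X]
    [LocallyCompactSpace X] [SecondCountableTopology X] {U : Set X} (hU : IsOpen U) :
    ∃ φ : ℕ → C_c(X, ℝ), (∀ n x, φ n x ∈ Set.Icc 0 (U.indicator 1 x)) ∧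
      ∀ x, Filter.Tendsto (fun n => φ n x) Filter.atTop (𝓝 (U.indicator 1 x)) := by
  have : LocallyCompactSpace U := hU.locallyCompactSpace
  let E := CompactExhaustion.choice U
  have hE : ∀ n, IsCompact (Subtype.val '' E n : Set X) := fun n =>
    (E.isCompact n).image continuous_subtype_val
  have hEU : ∀ n, (Subtype.val '' E n : Set X) ⊆ U := fun n => Subtype.coe_image_subset _ _
  choose φ h1 h2 h3 using fun n =>
    exists_compactlySupported_of_isCompact_subset_isOpen (hE n) hU (hEU n)
  have h0 : ∀ x ∉ U, ∀ n, φ n x = 0 := fun x hx n =>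
    image_eq_zero_of_notMem_tsupport fun h => hx (h2 n h)
  refine ⟨φ, fun n x => ⟨(h3 n x).1, ?_⟩, fun x => ?_⟩
  · by_cases hx : x ∈ U
    · simpa [hx] using (h3 n x).2
    · simp [hx, h0 x hx n]
  · by_cases hx : x ∈ U
    · obtain ⟨n, hn⟩ := E.exists_mem ⟨x, hx⟩
      refine tendsto_const_nhds.congr' ?_
      filter_upwards [Filter.eventually_ge_atTop n] with m hm
      rw [Set.indicator_of_mem hx]
      exact (h1 m ⟨_, E.subset hm hn, rfl⟩).symm
    · simp [hx, h0 x hx]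

/-- A countable family of compactly supported functions on `X` together with a generating
`π`-system `S` and a cover `T` by relatively compact open sets, such that the indicators of the
sets `s ∩ t` are bounded limits of functions of the family. -/
theorem exists_countable_approximating_family (X : Type*) [TopologicalSpace X] [T2Space X]
    [LocallyCompactSpace X] [SecondCountableTopology X] [mX : MeasurableSpace X] [BorelSpace X] :
    ∃ (D : Set C_c(X, ℝ)) (S T : Set (Set X)), D.Countable ∧
      MeasurableSpace.generateFrom S = mX ∧ IsPiSystem S ∧ Set.univ ∈ S ∧ (∀ s ∈ S, IsOpen s) ∧
      T.Countable ∧ ⋃₀ T = Set.univ ∧ (∀ t ∈ T, IsOpen t ∧ IsCompact (closure t)) ∧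
      ∀ s ∈ S, ∀ t ∈ T, ∃ φ : ℕ → C_c(X, ℝ), (∀ n, φ n ∈ D) ∧
        (∀ n x, φ n x ∈ Set.Icc 0 ((s ∩ t).indicator 1 x)) ∧
        ∀ x, Filter.Tendsto (fun n => φ n x) Filter.atTop (𝓝 ((s ∩ t).indicator 1 x)) := by
  let b := TopologicalSpace.countableBasis X
  let S : Set (Set X) := Set.sInter '' {F | F.Finite ∧ F ⊆ b}
  let E := CompactExhaustion.choice X
  let T : Set (Set X) := Set.range fun n => interior (E n)
  have hS : S.Countable :=
    (Set.countable_ofPred_finite_subset (TopologicalSpace.countable_countableBasis X)).image _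
  have hT : T.Countable := Set.countable_range _
  have hSo : ∀ s ∈ S, IsOpen s := by
    rintro _ ⟨F, ⟨hF, hFb⟩, rfl⟩
    exact hF.isOpen_sInter fun u hu => TopologicalSpace.isOpen_of_mem_countableBasis (hFb hu)
  have hTo : ∀ t ∈ T, IsOpen t := by
    rintro _ ⟨n, rfl⟩
    exact isOpen_interior
  choose! φ hφ1 hφ2 using fun (s : Set X) (t : Set X) (h : s ∈ S ∧ t ∈ T) =>
    exists_seq_tendsto_indicator ((hSo s h.1).inter (hTo t h.2))
  refine ⟨⋃ s ∈ S, ⋃ t ∈ T, Set.range (φ s t), S, T,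
    hS.biUnion fun s _ => hT.biUnion fun t _ => Set.countable_range _, ?_, ?_,
    ⟨∅, by simp, by simp⟩, hSo, hT, ?_, ?_, ?_⟩
  · refine le_antisymm (MeasurableSpace.generateFrom_le fun s hs => (hSo s hs).measurableSet) ?_
    rw [BorelSpace.measurable_eq (α := X),
      (TopologicalSpace.isBasis_countableBasis X).borel_eq_generateFrom]
    refine MeasurableSpace.generateFrom_mono fun u hu => ⟨{u}, by simpa using hu, by simp⟩
  · rintro _ ⟨F, ⟨hF, hFb⟩, rfl⟩ _ ⟨F', ⟨hF', hFb'⟩, rfl⟩ -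
    exact ⟨F ∪ F', ⟨hF.union hF', Set.union_subset hFb hFb'⟩, Set.sInter_union _ _⟩
  · refine Set.eq_univ_of_forall fun x => ?_
    obtain ⟨n, hn⟩ := E.exists_mem x
    exact ⟨_, ⟨n + 1, rfl⟩, E.subset_interior_succ n hn⟩
  · rintro _ ⟨n, rfl⟩
    refine ⟨isOpen_interior, (E.isCompact n).of_isClosed_subset isClosed_closure ?_⟩
    exact closure_minimal interior_subset (E.isCompact n).isClosed
  · intro s hs t ht
    exact ⟨φ s t, fun n => Set.mem_biUnion hs (Set.mem_biUnion ht ⟨n, rfl⟩),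
      hφ1 s t ⟨hs, ht⟩, hφ2 s t ⟨hs, ht⟩⟩

/-- Countably many products `φ ⊗ ψ` of compactly supported functions determine a measure on a
product space that is finite on compact sets. -/
theorem exists_countable_forall_integral_eq_imp_eq (X Y : Type*)
    [TopologicalSpace X] [T2Space X] [LocallyCompactSpace X] [SecondCountableTopology X]
    [MeasurableSpace X] [BorelSpace X]
    [TopologicalSpace Y] [T2Space Y] [LocallyCompactSpace Y] [SecondCountableTopology Y]
    [MeasurableSpace Y] [BorelSpace Y] :
    ∃ D : Set (C_c(X, ℝ) × C_c(Y, ℝ)), D.Countable ∧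
      ∀ (μ ν : Measure (X × Y)) [IsFiniteMeasureOnCompacts μ] [IsFiniteMeasureOnCompacts ν],
        (∀ d ∈ D, ∫ p, d.1 p.1 * d.2 p.2 ∂μ = ∫ p, d.1 p.1 * d.2 p.2 ∂ν) → μ = ν := by
  obtain ⟨D, S, T, hD, hSg, hSpi, hSu, hSo, hT, hTu, hTo, hφ⟩ :=
    exists_countable_approximating_family X
  obtain ⟨D', S', T', hD', hSg', hSpi', hSu', hSo', hT', hTu', hTo', hφ'⟩ :=
    exists_countable_approximating_family Y
  refine ⟨D ×ˢ D', hD.prod hD', fun μ ν _ _ h => ?_⟩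
  have hfin : ∀ t ∈ T, ∀ t' ∈ T', ∀ (m : Measure (X × Y)) [IsFiniteMeasureOnCompacts m],
      m (t ×ˢ t') < ⊤ := fun t ht t' ht' m _ =>
    (measure_mono (Set.prod_mono subset_closure subset_closure)).trans_lt
      (((hTo t ht).2.prod (hTo' t' ht').2).measure_lt_top)
  have key : ∀ t ∈ T, ∀ t' ∈ T', ∀ s ∈ S, ∀ s' ∈ S',
      μ ((s ∩ t) ×ˢ (s' ∩ t')) = ν ((s ∩ t) ×ˢ (s' ∩ t')) := by
    intro t ht t' ht' s hs s' hs'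
    obtain ⟨φ, hφD, hφb, hφl⟩ := hφ s hs t ht
    obtain ⟨ψ, hψD, hψb, hψl⟩ := hφ' s' hs' t' ht'
    have hmeas : MeasurableSet ((s ∩ t) ×ˢ (s' ∩ t')) :=
      ((hSo s hs).inter (hTo t ht).1).measurableSet.prod
        ((hSo' s' hs').inter (hTo' t' ht').1).measurableSet
    have hf : ∀ (m : Measure (X × Y)) [IsFiniteMeasureOnCompacts m],
        m ((s ∩ t) ×ˢ (s' ∩ t')) ≠ ⊤ := fun m _ =>
      ((measure_mono (Set.prod_mono Set.inter_subset_right Set.inter_subset_right)).trans_lt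
        (hfin t ht t' ht' m)).ne
    have hind : ∀ p : X × Y, ((s ∩ t) ×ˢ (s' ∩ t')).indicator (1 : X × Y → ℝ) p =
        (s ∩ t).indicator 1 p.1 * (s' ∩ t').indicator 1 p.2 := fun p =>
      Set.indicator_prod_one
    have hlim : ∀ (m : Measure (X × Y)) [IsFiniteMeasureOnCompacts m],
        Filter.Tendsto (fun n => ∫ p, φ n p.1 * ψ n p.2 ∂m) Filter.atTop
          (𝓝 (m.real ((s ∩ t) ×ˢ (s' ∩ t')))) := by
      intro m _
      rw [← integral_indicator_one hmeas]
      refine tendsto_integral_of_dominated_convergence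
        (((s ∩ t) ×ˢ (s' ∩ t')).indicator (1 : X × Y → ℝ)) (fun n => ?_) ?_ (fun n => ?_) ?_
      · exact (((φ n).continuous.comp _root_.continuous_fst).mul
          ((ψ n).continuous.comp _root_.continuous_snd)).aestronglyMeasurable
      · exact (integrable_indicator_iff hmeas).2 (integrableOn_const (hf m))
      · refine ae_of_all _ fun p => ?_
        rw [hind, Real.norm_of_nonneg (mul_nonneg (hφb n _).1 (hψb n _).1)]
        exact mul_le_mul (hφb n _).2 (hψb n _).2 (hψb n _).1 ((hφb n _).1.trans (hφb n _).2)
      · refine ae_of_all _ fun p => ?_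
        rw [hind]
        exact (hφl _).mul (hψl _)
    have heq := tendsto_nhds_unique (hlim μ)
      ((hlim ν).congr fun n => (h (φ n, ψ n) ⟨hφD n, hψD n⟩).symm)
    exact (ENNReal.toReal_eq_toReal_iff' (hf μ) (hf ν)).1 heq
  refine Measure.ext_of_generateFrom_of_cover
    (S := Set.image2 (· ×ˢ ·) S S') (T := Set.image2 (· ×ˢ ·) T T')
    (generateFrom_eq_prod hSg hSg' ⟨fun _ => Set.univ, fun _ => hSu, Set.iUnion_const _⟩
      ⟨fun _ => Set.univ, fun _ => hSu', Set.iUnion_const _⟩).symm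
    (hT.image2 hT' _) (hSpi.prod hSpi') ?_ ?_ ?_ ?_
  · refine Set.eq_univ_of_forall fun p => ?_
    obtain ⟨t, ht, hpt⟩ := hTu.ge (Set.mem_univ p.1)
    obtain ⟨t', ht', hpt'⟩ := hTu'.ge (Set.mem_univ p.2)
    exact ⟨_, ⟨t, ht, t', ht', rfl⟩, hpt, hpt'⟩
  · rintro _ ⟨t, ht, t', ht', rfl⟩
    exact (hfin t ht t' ht' μ).ne
  · rintro _ ⟨t, ht, t', ht', rfl⟩ _ ⟨s, hs, s', hs', rfl⟩
    rw [Set.prod_inter_prod]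
    exact key t ht t' ht' s hs s' hs'
  · rintro _ ⟨t, ht, t', ht', rfl⟩
    simpa using key t ht t' ht' _ hSu _ hSu'

end Determining

/-! ### Compactness and metrizability -/

section Compactness

set_option linter.unusedSectionVars false

variable {G H : Type*}
    [Group G] [TopologicalSpace G] [MeasurableSpace G]
    [Group H] [TopologicalSpace H] [MeasurableSpace H]
    {γ : Measure G} {η : Measure H}
    [IsTopologicalGroup G] [T2Space G] [LocallyCompactSpace G]
    [SecondCountableTopology G] [BorelSpace G]
    [IsTopologicalGroup H] [T2Space H] [LocallyCompactSpace H]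
    [SecondCountableTopology H] [BorelSpace H]

/-- The support of a nonzero measure that is invariant under translation by each point of its
support, as a subgroup. -/
def MeasureTheory.Measure.supportSubgroup (μ : Measure G) (h0 : μ ≠ 0)
    (hinv : ∀ x ∈ μ.support, μ.map (x * ·) = μ) : Subgroup G :=
  have key : ∀ x ∈ μ.support, ∀ y, x * y ∈ μ.support ↔ y ∈ μ.support := by
    intro x hx y
    have hμ : ∀ U : Set G, μ ((x * ·) ⁻¹' U) = μ U := fun U => by
      conv_rhs => rw [← hinv x hx]
      exact ((MeasurableEquiv.mulLeft x).map_apply U).symm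
    simp only [Measure.mem_support_iff_forall]
    constructor
    · intro h U hU
      have hU' : (x⁻¹ * ·) ⁻¹' U ∈ 𝓝 (x * y) :=
        (continuous_const_mul x⁻¹).continuousAt (by simpa using hU)
      have := h _ hU'
      rw [← hμ] at this
      convert this using 2
      ext z
      simp
    · intro h U hU
      rw [← hμ]
      exact h _ ((continuous_const_mul x).continuousAt hU)
  have one : (1 : G) ∈ μ.support := by
    obtain ⟨x, hx⟩ := Measure.nonempty_support h0
    exact (key x hx 1).1 (by rwa [mul_one])
  { carrier := μ.support
    one_mem' := one
    mul_mem' := fun {x y} hx hy => (key x hx y).2 hy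
    inv_mem' := fun {x} hx => (key x hx x⁻¹).1 (by rwa [mul_inv_cancel]) }

theorem MeasureTheory.Measure.isHaarMeasure_comap_supportSubgroup (μ : Measure G)
    [IsFiniteMeasureOnCompacts μ] (h0 : μ ≠ 0)
    (hinv : ∀ x ∈ μ.support, μ.map (x * ·) = μ) :
    (μ.comap (Subtype.val : μ.supportSubgroup h0 hinv → G)).IsHaarMeasure := by
  have hme : MeasurableEmbedding (Subtype.val : μ.supportSubgroup h0 hinv → G) :=
    MeasurableEmbedding.subtype_coe Measure.isClosed_support.measurableSet
  refine { lt_top_of_isCompact := fun {C} hC => ?_, map_mul_left_eq_self := fun g => ?_,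
           open_pos := ?_ }
  · rw [hme.comap_apply]
    exact (hC.image continuous_subtype_val).measure_lt_top
  · ext s hs
    rw [Measure.map_apply (measurable_const_mul g) hs, hme.comap_apply, hme.comap_apply]
    have hgs : μ (Subtype.val '' s) = μ (((g : G) * ·) ⁻¹' (Subtype.val '' s)) := by
      rw [← Measure.map_apply (measurable_const_mul _) (hme.measurableSet_image.2 hs)]
      exact congrArg (fun m : Measure G => m (Subtype.val '' s)) (hinv g g.2).symm
    rw [hgs]
    congr 1
    ext x
    constructor
    · rintro ⟨y, hy, rfl⟩
      exact ⟨g * y, hy, rfl⟩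
    · rintro ⟨y, hy, hxy : (y : G) = g * x⟩
      have hx : x = ((g⁻¹ * y : μ.supportSubgroup h0 hinv) : G) := by simp [hxy]
      exact ⟨g⁻¹ * y, by simpa using hy, hx.symm⟩
  · rintro _ ⟨V, hV, rfl⟩ ⟨x, hx⟩
    have hV' : (Subtype.val : μ.supportSubgroup h0 hinv → G) '' (Subtype.val ⁻¹' V) =
        μ.support ∩ V := Subtype.image_preimage_coe μ.support V
    rw [hme.comap_apply, hV',
      Measure.measure_inter_eq_of_ae (t := μ.support) Measure.support_mem_ae]
    exact ((Measure.mem_support_iff_forall _).1 x.2 V (hV.mem_nhds hx)).ne'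

namespace Polh

/-- A polyhomomorphism as a measure on `G × H`. -/
noncomputable def toMeasure : Polh γ η → Measure (G × H)
  | zero => 0
  | of R => R.haar.map Subtype.val

theorem map_fst_toMeasure_le (P : Polh γ η) : (toMeasure P).map Prod.fst ≤ γ := by
  cases P with
  | zero => simpa [toMeasure] using Measure.zero_le γ
  | of R =>
    rw [toMeasure, Measure.map_map measurable_fst measurable_subtype_coe]
    exact R.map_fst_le

theorem map_snd_toMeasure_le (P : Polh γ η) : (toMeasure P).map Prod.snd ≤ η := by
  cases P with
  | zero => simpa [toMeasure] using Measure.zero_le η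
  | of R =>
    rw [toMeasure, Measure.map_map measurable_snd measurable_subtype_coe]
    exact R.map_snd_le

theorem integral_eq_integral_toMeasure (φ : C_c(G, ℝ)) (ψ : C_c(H, ℝ)) (P : Polh γ η) :
    integral φ ψ P = ∫ p, φ p.1 * ψ p.2 ∂toMeasure P := by
  cases P with
  | zero => simp [integral, toMeasure]
  | of R =>
    refine (integral_map (f := fun p : G × H => φ p.1 * ψ p.2)
      measurable_subtype_coe.aemeasurable ?_).symm
    exact ((φ.continuous.comp continuous_fst).mul
      (ψ.continuous.comp continuous_snd)).aestronglyMeasurable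

/-- Polyhomomorphisms are uniformly bounded on compact sets, because their images in `G` are
dominated by `γ`. -/
theorem toMeasure_le (P : Polh γ η) {C : Set (G × H)} (hC : IsCompact C) :
    toMeasure P C ≤ γ (Prod.fst '' C) := by
  refine (measure_mono (Set.subset_preimage_image Prod.fst C)).trans ?_
  rw [← Measure.map_apply measurable_fst (hC.image continuous_fst).measurableSet]
  exact map_fst_toMeasure_le P _

instance [IsFiniteMeasureOnCompacts γ] (P : Polh γ η) :
    IsFiniteMeasureOnCompacts (toMeasure P) :=
  ⟨fun _ hC => (toMeasure_le P hC).trans_lt (hC.image continuous_fst).measure_lt_top⟩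

theorem support_toMeasure_of (R : NonzeroPolh γ η) :
    (toMeasure (of R)).support = (R.rel : Set (G × H)) := by
  refine Set.Subset.antisymm (Measure.support_subset_of_isClosed R.isClosed ?_) fun x hx => ?_
  · refine (ae_map_iff measurable_subtype_coe.aemeasurable R.isClosed.measurableSet).2 ?_
    exact ae_of_all _ fun r => r.2
  · refine (Measure.mem_support_iff_forall x).2 fun U hU => ?_
    have hU' : (Subtype.val : R.rel → G × H) ⁻¹' U ∈ 𝓝 (⟨x, hx⟩ : R.rel) :=
      continuous_subtype_val.continuousAt hU
    exact (Measure.measure_pos_of_mem_nhds R.haar hU').trans_le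
      (Measure.le_map_apply measurable_subtype_coe.aemeasurable U)

theorem map_mul_left_toMeasure (P : Polh γ η) {x : G × H} (hx : x ∈ (toMeasure P).support) :
    (toMeasure P).map (x * ·) = toMeasure P := by
  cases P with
  | zero => simp [toMeasure]
  | of R =>
    rw [support_toMeasure_of] at hx
    conv_rhs => rw [toMeasure, ← map_mul_left_eq_self R.haar ⟨x, hx⟩]
    rw [toMeasure, Measure.map_map (measurable_const_mul x) measurable_subtype_coe,
      Measure.map_map measurable_subtype_coe (measurable_const_mul _)]
    rfl

theorem toMeasure_of_ne_zero (R : NonzeroPolh γ η) : toMeasure (of R) ≠ 0 := by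
  rw [toMeasure, Ne, Measure.map_eq_zero_iff measurable_subtype_coe.aemeasurable]
  exact NeZero.ne _

theorem toMeasure_injective : Function.Injective (toMeasure : Polh γ η → Measure (G × H)) := by
  intro P Q h
  cases P with
  | zero =>
    cases Q with
    | zero => rfl
    | of Q => exact (toMeasure_of_ne_zero Q h.symm).elim
  | of P =>
    cases Q with
    | zero => exact (toMeasure_of_ne_zero P h).elim
    | of Q =>
      have hrel : P.rel = Q.rel := by
        apply SetLike.coe_injective
        rw [← support_toMeasure_of, ← support_toMeasure_of, h]
      obtain ⟨rel, cl, ρ, hρ, h1, h2⟩ := P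
      obtain ⟨rel', cl', ρ', hρ', h1', h2'⟩ := Q
      obtain rfl : rel = rel' := hrel
      have hme : MeasurableEmbedding (Subtype.val : rel → G × H) :=
        MeasurableEmbedding.subtype_coe cl.measurableSet
      have : ρ = ρ' := by
        rw [← hme.comap_map ρ, ← hme.comap_map ρ']
        exact congrArg _ h
      subst this
      rfl

/-- Polyhomomorphisms are exactly the measures with dominated images that are invariant under
translation by the points of their support. -/
theorem exists_toMeasure_eq (μ : Measure (G × H)) [IsFiniteMeasureOnCompacts μ]
    (h1 : μ.map Prod.fst ≤ γ) (h2 : μ.map Prod.snd ≤ η)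
    (hinv : ∀ x ∈ μ.support, μ.map (x * ·) = μ) : ∃ P : Polh γ η, toMeasure P = μ := by
  by_cases h0 : μ = 0
  · exact ⟨zero, h0.symm⟩
  have hcl : IsClosed (μ.supportSubgroup h0 hinv : Set (G × H)) := Measure.isClosed_support
  have hmap : (μ.comap (Subtype.val : μ.supportSubgroup h0 hinv → G × H)).map Subtype.val = μ := by
    refine (map_comap_subtype_coe hcl.measurableSet μ).trans ?_
    exact Measure.restrict_eq_self_of_ae_mem Measure.support_mem_ae
  refine ⟨of ⟨μ.supportSubgroup h0 hinv, hcl, μ.comap Subtype.val,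
    μ.isHaarMeasure_comap_supportSubgroup h0 hinv, ?_, ?_⟩, hmap⟩
  · rw [← hmap, Measure.map_map measurable_fst measurable_subtype_coe] at h1
    exact h1
  · rw [← hmap, Measure.map_map measurable_snd measurable_subtype_coe] at h2
    exact h2

variable (γ η) [γ.IsHaarMeasure] [η.IsHaarMeasure]

theorem compactSpace : CompactSpace (Polh γ η) := by
  refine ⟨isCompact_iff_ultrafilter_le_nhds.2 fun 𝓕 _ => ?_⟩
  have hbdd : ∀ C : Set (G × H), IsCompact C →
      ∃ M : ℝ, ∀ P : Polh γ η, (toMeasure P).real C ≤ M := fun C hC =>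
    ⟨γ.real (Prod.fst '' C), fun P =>
      ENNReal.toReal_mono (hC.image continuous_fst).measure_lt_top.ne (toMeasure_le P hC)⟩
  obtain ⟨μ, hμ, hlim⟩ := exists_forall_tendsto_integral 𝓕 hbdd
  obtain ⟨P, rfl⟩ := exists_toMeasure_eq (γ := γ) (η := η) μ
    (map_le_of_forall_tendsto_integral hlim continuous_fst γ map_fst_toMeasure_le)
    (map_le_of_forall_tendsto_integral hlim continuous_snd η map_snd_toMeasure_le)
    (fun x hx => map_mul_left_eq_self_of_forall_tendsto_integral hlim hbdd
      (fun P x hx => map_mul_left_toMeasure P hx) hx)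
  refine ⟨P, trivial, tendsto_iff.2 fun φ ψ => ?_⟩
  simp only [integral_eq_integral_toMeasure]
  refine hlim ⟨⟨fun p => φ p.1 * ψ p.2, (φ.continuous.comp continuous_fst).mul
    (ψ.continuous.comp continuous_snd)⟩, HasCompactSupport.intro
    (φ.hasCompactSupport.isCompact.prod ψ.hasCompactSupport.isCompact) fun p hp => ?_⟩
  by_contra hne
  exact hp ⟨subset_tsupport φ (left_ne_zero_of_mul hne),
    subset_tsupport ψ (right_ne_zero_of_mul hne)⟩

/-- Countably many of the integrals defining the topology separate the points of the compact space
`Polh γ η`, and so embed it in a countable product of lines. -/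
theorem metrizableSpace : TopologicalSpace.MetrizableSpace (Polh γ η) := by
  have := compactSpace γ η
  obtain ⟨D, hD, h⟩ := exists_countable_forall_integral_eq_imp_eq G H
  have : Countable D := hD.to_subtype
  let F : Polh γ η → D → ℝ := fun P d => integral d.1.1 d.1.2 P
  have hF : Continuous F := continuous_pi fun d => continuous_integral _ _
  have hinj : Function.Injective F := fun P Q hPQ => toMeasure_injective <|
    h _ _ fun d hd => by
      rw [← integral_eq_integral_toMeasure, ← integral_eq_integral_toMeasure]
      exact congrFun hPQ ⟨d, hd⟩
  exact (hF.isClosedEmbedding hinj).isEmbedding.metrizableSpace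

end Polh

end Compactness

theorem mainTheorem3 {G H K : Type*}
    [Group G] [TopologicalSpace G] [IsTopologicalGroup G] [T2Space G] [LocallyCompactSpace G]
    [SecondCountableTopology G] [MeasurableSpace G] [BorelSpace G]
    [Group H] [TopologicalSpace H] [IsTopologicalGroup H] [T2Space H] [LocallyCompactSpace H]
    [SecondCountableTopology H] [MeasurableSpace H] [BorelSpace H]
    [Group K] [TopologicalSpace K] [IsTopologicalGroup K] [T2Space K] [LocallyCompactSpace K]
    [SecondCountableTopology K] [MeasurableSpace K] [BorelSpace K]
    (γ : Measure G) [γ.IsHaarMeasure] [γ.IsMulRightInvariant]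
    (η : Measure H) [η.IsHaarMeasure] [η.IsMulRightInvariant]
    (κ : Measure K) [κ.IsHaarMeasure] [κ.IsMulRightInvariant] :
    (TopologicalSpace.MetrizableSpace (Polh γ η) ∧ CompactSpace (Polh γ η)) ∧
    (∀ (R : Polh γ η) (T : Polh η κ),
      Polh.IsProduct R T (T.mul R) ∧ ∀ S : Polh γ κ, Polh.IsProduct R T S → S = T.mul R) ∧
    (∀ T : Polh η κ, Continuous fun R : Polh γ η => T.mul R) ∧
    (∀ R : Polh γ η, Continuous fun T : Polh η κ => T.mul R) :=
  ⟨⟨Polh.metrizableSpace γ η, Polh.compactSpace γ η⟩,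
    fun R T => ⟨Polh.isProduct_mul R T, fun _ hS => hS.unique (Polh.isProduct_mul R T)⟩,
    Polh.continuous_mul_left, Polh.continuous_mul_right⟩
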